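/- Let $(M,g)$ be a smooth four-dimensional spacetime (signature $(-,+,+,+)$) satisfying the Einstein vacuum equations $R_{\mu\nu}-\tfrac12 R\,g_{\mu\nu}=0$, and let $\Sigma$ be a flat three-dimensional spacelike hypersurface immersed in $M$, described by Cartesian coordinates $x=(x^1,x^2,x^3)$ ranging over an open set $U\subset\mathbb R^3$, in which the induced metric is $\gamma_{ij}=\delta_{ij}$. Let $n$ be a smooth unit normal of $\Sigma$, $g(n,n)=-1$, and let - $K_{ij}=-g(\nabla_i n,\partial_j)$ be the extrinsic curvature, $K=K^i{}_i$, and $P^i{}_j=-K^i{}_j+K\,\delta^i{}_j$ the ADM momentum; - $B_{\alpha\beta}=W^*{}_{\alpha\mu\nu\beta}\,n^\mu n^\nu$ be the magnetic part of the Weyl tensor $W$ of $g$, where $W^*{}_{\alpha\beta\mu\nu}=\tfrac12 W_{\alpha\beta\lambda\delta}\,\varepsilon^{\lambda\delta}{}_{\mu\nu}$, the Riemann tensor is normalised by $(\nabla_\mu\nabla_\nu-\nabla_\nu\nabla_\mu)v^\rho=R^\rho{}_{\sigma\mu\nu}v^\sigma$, and the antisymmetric tensor is normalised so that $\varepsilon^{\alpha\beta\gamma\delta}$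 equals $+1$ on the (dual of the) orthonormal frame $(\partial_1,\partial_2,\partial_3,n)$, in this order; $B_{ij}$ denotes its components tangent to $\Sigma$. In the Cartesian coordinates consider the vector fields ($\varepsilon_{123}=1$, $r^2=x_ix^i$, $k=1,2,3$) $$\mathcal T_k=\partial_k,\qquad \mathcal R_k=\varepsilon_k{}^{ij}x_i\partial_j,\qquad \mathcal S=x^j\partial_j,\qquad \mathcal K_k=x_k\,\mathcal S-\tfrac12 r^2\partial_k .$$ Assume that the three-dimensional divergence of the magnetic part vanishes on $\Sigma$, $B^i{}_{j|i}=0$. Let $A$ be a closed (compact, without boundary) oriented smooth surface immersed in $\Sigma$, with $dS_i=\nu_i\,dA$ for its unit normal $\nu$ in $\Sigma$ and its area element $dA$, and assume that the three charges $$Q(B,\mathcal T_k)=\int_A B^i{}_j\,\mathcal T_k^j\,dS_i,\qquad k=1,2,3,$$ vanish. Then for every $k\in\{1,2,3\}$ $$\int_A B^i{}_j\,\mathcal K_k^j\,dS_i=\int_A P^i{}_j\,\mathcal R_k^j\,dS_i .$$ -/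

import Mathlib

open scoped Manifold ContDiff

noncomputable section

namespace FlatSlice

/-- Euclidean space `ℝⁿ`. -/
abbrev Eu (n : ℕ) : Type := EuclideanSpace ℝ (Fin n)

/-- Coordinate basis vector `e_i` of `ℝⁿ`. -/
def e {n : ℕ} (i : Fin n) : Eu n := EuclideanSpace.single i 1

/-- Partial derivative `∂_i f` of a function on `ℝⁿ`. -/
def pd {n : ℕ} (i : Fin n) (f : Eu n → ℝ) (y : Eu n) : ℝ := fderiv ℝ f y (e i)

/-- The totally antisymmetric symbol on `n` indices, with value `1` on `(0, 1, …, n - 1)`. -/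
def symb {n : ℕ} (s : Fin n → Fin n) : ℝ :=
  (Matrix.of fun a b => if s a = b then (1 : ℝ) else 0).det

/-! ### Curvature of a metric given by its components in a four-dimensional chart -/

section Curvature

/-- Christoffel symbols `Γ^l_{mn}` of the metric components `G`. -/
def christoffel (G : Eu 4 → Matrix (Fin 4) (Fin 4) ℝ) (l m n : Fin 4) (y : Eu 4) : ℝ :=
  (1 / 2) * ∑ s, (G y)⁻¹ l s *
    (pd m (fun z => G z s n) y + pd n (fun z => G z s m) y - pd s (fun z => G z m n) y)

/-- Riemann tensor `R^r_{smn}`, normalised by `(∇_m ∇_n - ∇_n ∇_m) v^r = R^r_{smn} v^s`. -/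
def riemannUp (G : Eu 4 → Matrix (Fin 4) (Fin 4) ℝ) (r s m n : Fin 4) (y : Eu 4) : ℝ :=
  pd m (christoffel G r n s) y - pd n (christoffel G r m s) y
    + ∑ l, (christoffel G r m l y * christoffel G l n s y
      - christoffel G r n l y * christoffel G l m s y)

/-- Riemann tensor `R_{abmn}` with all indices lowered. -/
def riemann (G : Eu 4 → Matrix (Fin 4) (Fin 4) ℝ) (a b m n : Fin 4) (y : Eu 4) : ℝ :=
  ∑ r, G y a r * riemannUp G r b m n y

/-- Ricci tensor `R_{bn} = R^r_{brn}`. -/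
def ricci (G : Eu 4 → Matrix (Fin 4) (Fin 4) ℝ) (b n : Fin 4) (y : Eu 4) : ℝ :=
  ∑ r, riemannUp G r b r n y

/-- Scalar curvature `R = g^{bn} R_{bn}`. -/
def scalarCurv (G : Eu 4 → Matrix (Fin 4) (Fin 4) ℝ) (y : Eu 4) : ℝ :=
  ∑ b, ∑ n, (G y)⁻¹ b n * ricci G b n y

/-- Weyl tensor
`W_{abmn} = R_{abmn} - (g_{a[m} R_{n]b} - g_{b[m} R_{n]a}) + (1/3) R g_{a[m} g_{n]b}`. -/
def weyl (G : Eu 4 → Matrix (Fin 4) (Fin 4) ℝ) (a b m n : Fin 4) (y : Eu 4) : ℝ :=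
  riemann G a b m n y
    - ((1 / 2) * (G y a m * ricci G n b y - G y a n * ricci G m b y)
      - (1 / 2) * (G y b m * ricci G n a y - G y b n * ricci G m a y))
    + (1 / 3) * scalarCurv G y * ((1 / 2) * (G y a m * G y n b - G y a n * G y m b))

/-- The antisymmetric tensor `ε^{lk}_{mn}`; `o = ±1` is the orientation of the chart, and
`o √|det g| ε^{0123} = 1` in the chart. -/
def epsMixed (G : Eu 4 → Matrix (Fin 4) (Fin 4) ℝ) (o : ℝ) (l k m n : Fin 4) (y : Eu 4) : ℝ :=
  ∑ r, ∑ s, o * symb ![l, k, r, s] / √|(G y).det| * G y r m * G y s n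

/-- The dual `W*_{abmn} = (1/2) W_{ablk} ε^{lk}_{mn}` of the Weyl tensor. -/
def weylDual (G : Eu 4 → Matrix (Fin 4) (Fin 4) ℝ) (o : ℝ) (a b m n : Fin 4) (y : Eu 4) : ℝ :=
  (1 / 2) * ∑ l, ∑ k, weyl G a b l k y * epsMixed G o l k m n y

end Curvature

/-! ### Spacetimes -/

section Spacetime

variable (M : Type*) [TopologicalSpace M] [ChartedSpace (Eu 4) M] [IsManifold (𝓡 4) ∞ M]

/-- A smooth metric of signature `(-, +, +, +)` on a four-dimensional manifold. -/
structure LorentzianMetric where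
  val (p : M) : TangentSpace (𝓡 4) p →L[ℝ] TangentSpace (𝓡 4) p →L[ℝ] ℝ
  symm (p : M) (v w : TangentSpace (𝓡 4) p) : val p v w = val p w v
  signature (p : M) : ∃ b : Module.Basis (Fin 4) ℝ (TangentSpace (𝓡 4) p),
    ∀ i j, val p (b i) (b j) = if i = j then (if i = 0 then -1 else 1) else 0
  contMDiff : ContMDiff (𝓡 4) ((𝓡 4).prod 𝓘(ℝ, Eu 4 →L[ℝ] Eu 4 →L[ℝ] ℝ)) ∞
    (fun p => Bundle.TotalSpace.mk' (Eu 4 →L[ℝ] Eu 4 →L[ℝ] ℝ) p (val p))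

end Spacetime

section Charts

variable {M : Type*} [TopologicalSpace M] [ChartedSpace (Eu 4) M] [IsManifold (𝓡 4) ∞ M]

/-- Components `g_{mn}` of the metric in the chart around `p`, as functions of the coordinates. -/
def LorentzianMetric.inChart (g : LorentzianMetric M) (p : M) (y : Eu 4) :
    Matrix (Fin 4) (Fin 4) ℝ :=
  Matrix.of fun m n =>
    g.val ((extChartAt (𝓡 4) p).symm y)
      (mfderiv (𝓡 4) (𝓡 4) (extChartAt (𝓡 4) p).symm y (e m))
      (mfderiv (𝓡 4) (𝓡 4) (extChartAt (𝓡 4) p).symm y (e n))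

/-- Component `v^m`, in the chart around `p`, of a tangent vector `v` at a point `q` of its
domain. -/
def comp (p : M) {q : M} (v : TangentSpace (𝓡 4) q) (m : Fin 4) : ℝ :=
  (show Eu 4 from mfderiv (𝓡 4) (𝓡 4) (extChartAt (𝓡 4) p) q v) m

/-- Einstein's vacuum equations `R_{mn} - (1/2) R g_{mn} = 0` at every point of `M`. -/
def LorentzianMetric.IsVacuum (g : LorentzianMetric M) : Prop :=
  ∀ (p : M) (m n : Fin 4),
    ricci (g.inChart p) m n (extChartAt (𝓡 4) p p)
      - (1 / 2) * scalarCurv (g.inChart p) (extChartAt (𝓡 4) p p)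
        * g.inChart p (extChartAt (𝓡 4) p p) m n = 0

/-- A flat spacelike hypersurface immersed in `(M, g)`, parametrised by Cartesian coordinates:
the coordinates range over an open set `U` of `ℝ³`, and the metric induced by the immersion `Φ`
is `γ_{ij} = δ_{ij}`. The hypersurface carries a smooth unit normal field `normal`. -/
structure FlatHypersurface (g : LorentzianMetric M) where
  U : Set (Eu 3)
  isOpen : IsOpen U
  Φ : Eu 3 → M
  smooth : ContMDiffOn (𝓡 3) (𝓡 4) ∞ Φ U
  flat : ∀ x ∈ U, ∀ i j : Fin 3,
    g.val (Φ x) (mfderiv (𝓡 3) (𝓡 4) Φ x (e i)) (mfderiv (𝓡 3) (𝓡 4) Φ x (e j))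
      = if i = j then 1 else 0
  normal (x : Eu 3) : TangentSpace (𝓡 4) (Φ x)
  normal_smooth : ContMDiffOn (𝓡 3) (𝓡 4).tangent ∞
    (fun x => (⟨Φ x, normal x⟩ : TangentBundle (𝓡 4) M)) U
  normal_unit : ∀ x ∈ U, g.val (Φ x) (normal x) (normal x) = -1
  normal_orthogonal : ∀ x ∈ U, ∀ i : Fin 3,
    g.val (Φ x) (normal x) (mfderiv (𝓡 3) (𝓡 4) Φ x (e i)) = 0

namespace FlatHypersurface

variable {g : LorentzianMetric M} (Sg : FlatHypersurface g)

/-- Component `(∂_i Φ)^m` at `x`, in the chart around `Φ x`. -/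
def tangentComp (x : Eu 3) (i : Fin 3) (m : Fin 4) : ℝ :=
  comp (Sg.Φ x) (mfderiv (𝓡 3) (𝓡 4) Sg.Φ x (e i)) m

/-- Component `n^m` of the unit normal at `x'`, in the chart around `Φ x`. -/
def normalComp (x x' : Eu 3) (m : Fin 4) : ℝ :=
  comp (Sg.Φ x) (Sg.normal x') m

/-- Component `(∇_i n)^l = ∂_i n^l + Γ^l_{mn} (∂_i Φ)^m n^n` at `x`, in the chart around
`Φ x`. -/
def covDerivNormal (x : Eu 3) (i : Fin 3) (l : Fin 4) : ℝ :=
  pd i (fun x' => Sg.normalComp x x' l) x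
    + ∑ m, ∑ n, christoffel (g.inChart (Sg.Φ x)) l m n (extChartAt (𝓡 4) (Sg.Φ x) (Sg.Φ x))
        * Sg.tangentComp x i m * Sg.normalComp x x n

/-- Extrinsic curvature `K_{ij} = - g(∇_i n, ∂_j Φ)`. -/
def extrinsic (x : Eu 3) (i j : Fin 3) : ℝ :=
  - ∑ l, ∑ m, g.inChart (Sg.Φ x) (extChartAt (𝓡 4) (Sg.Φ x) (Sg.Φ x)) l m
      * Sg.covDerivNormal x i l * Sg.tangentComp x j m

/-- ADM momentum `P^i_j = - K^i_j + K δ^i_j`, where `K = K^i_i`. -/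
def admMomentum (x : Eu 3) (i j : Fin 3) : ℝ :=
  - Sg.extrinsic x i j + (∑ l, Sg.extrinsic x l l) * (if i = j then 1 else 0)

/-- The sign (`1` or `-1`) of the chart around `Φ x`, for the orientation of spacetime in which
`(∂_1 Φ, ∂_2 Φ, ∂_3 Φ, n)` is a positive frame. -/
def chartSign (x : Eu 3) : ℝ :=
  Real.sign (Matrix.of fun m a : Fin 4 =>
    (![Sg.tangentComp x 0 m, Sg.tangentComp x 1 m, Sg.tangentComp x 2 m,
      Sg.normalComp x x m] : Fin 4 → ℝ) a).det

/-- Magnetic part of the Weyl tensor, `B_{ab} = W*_{amnb} n^m n^n`, restricted to the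
hypersurface: `B_{ij} = B_{ab} (∂_i Φ)^a (∂_j Φ)^b`. -/
def magnetic (x : Eu 3) (i j : Fin 3) : ℝ :=
  ∑ a, ∑ b, ∑ m, ∑ n,
    weylDual (g.inChart (Sg.Φ x)) (Sg.chartSign x) a m n b (extChartAt (𝓡 4) (Sg.Φ x) (Sg.Φ x))
      * Sg.normalComp x x m * Sg.normalComp x x n
      * Sg.tangentComp x i a * Sg.tangentComp x j b

end FlatHypersurface

end Charts

/-! ### Conformal Killing fields of flat space, in Cartesian coordinates -/

/-- Translation generator `T_k = ∂_k`. -/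
def translation (k : Fin 3) (_x : Eu 3) (j : Fin 3) : ℝ := if j = k then 1 else 0

/-- Rotation generator `R_k = ε_k^{ij} x_i ∂_j`. -/
def rotation (k : Fin 3) (x : Eu 3) (j : Fin 3) : ℝ := ∑ i, symb ![k, i, j] * x i

/-- Scaling generator `S = x^j ∂_j`. -/
def scaling (x : Eu 3) (j : Fin 3) : ℝ := x j

/-- Generator of proper conformal transformations `K_k = x_k S - (1/2) r² ∂_k`. -/
def properConformal (k : Fin 3) (x : Eu 3) (j : Fin 3) : ℝ :=
  x k * scaling x j - (1 / 2) * ‖x‖ ^ 2 * translation k x j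

/-! ### Closed surfaces and fluxes -/

section Surface

variable (S : Type*) [TopologicalSpace S] [ChartedSpace (Eu 2) S] [IsManifold (𝓡 2) ∞ S]

/-- An immersion of `S` into the open set `U` of `ℝ³`, with a continuous unit normal field `ν`.
If `S` is compact this is a closed oriented surface in `U`. -/
structure ImmersedSurface (U : Set (Eu 3)) where
  f : S → Eu 3
  mem : ∀ p, f p ∈ U
  smooth : ContMDiff (𝓡 2) (𝓡 3) ∞ f
  immersion : ∀ p, Function.Injective (mfderiv (𝓡 2) (𝓡 3) f p)
  ν : S → Eu 3
  ν_continuous : Continuous ν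
  ν_unit : ∀ p, ‖ν p‖ = 1
  ν_orthogonal : ∀ (p : S) (v : TangentSpace (𝓡 2) p),
    inner ℝ (ν p) (show Eu 3 from mfderiv (𝓡 2) (𝓡 3) f p v) = 0

variable [CompactSpace S] [T2Space S]

/-- A smooth partition of unity on `S` subordinate to the charts. -/
def chartPartition : SmoothPartitionOfUnity S (𝓡 2) S Set.univ :=
  (SmoothPartitionOfUnity.exists_isSubordinate_chartAt_source (𝓡 2) S).choose

theorem chartPartition_isSubordinate :
    (chartPartition S).IsSubordinate (fun p => (chartAt (Eu 2) p).source) :=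
  (SmoothPartitionOfUnity.exists_isSubordinate_chartAt_source (𝓡 2) S).choose_spec

variable {S} {U : Set (Eu 3)}

/-- Area density `√det(⟪∂_a f, ∂_b f⟫)` of the surface in the chart around `p`. -/
def ImmersedSurface.areaDensity (A : ImmersedSurface S U) (p : S) (u : Eu 2) : ℝ :=
  √(Matrix.of fun a b : Fin 2 =>
    inner ℝ (fderiv ℝ (A.f ∘ (extChartAt (𝓡 2) p).symm) u (e a))
      (fderiv ℝ (A.f ∘ (extChartAt (𝓡 2) p).symm) u (e b))).det

/-- Integral of a function over the surface, with respect to the area element of the metric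
induced from `ℝ³`. -/
def ImmersedSurface.areaIntegral (A : ImmersedSurface S U) (h : S → ℝ) : ℝ :=
  ∑ᶠ p : S, ∫ u in (extChartAt (𝓡 2) p).target,
    chartPartition S p ((extChartAt (𝓡 2) p).symm u) * h ((extChartAt (𝓡 2) p).symm u)
      * A.areaDensity p u

/-- The flux `∫_A T^i_j X^j dS_i` of the contraction of the tensor field `T` with the vector
field `X`, where `dS_i = ν_i dA`. -/
def ImmersedSurface.flux (A : ImmersedSurface S U) (T : Eu 3 → Fin 3 → Fin 3 → ℝ)
    (X : Eu 3 → Fin 3 → ℝ) : ℝ :=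
  A.areaIntegral fun p => ∑ i, ∑ j, T (A.f p) i j * X (A.f p) j * A.ν p i

end Surface

end FlatSlice

end

/-! The two flux densities differ by a curl, and the flux of a curl through a closed surface is
zero.

In vacuum the Weyl tensor equals the Riemann tensor, so the magnetic part only involves components
`g(∂_k, R(∂_i, ∂_j) n)`. Because the induced metric is flat and written in Cartesian coordinates,
the Codazzi equation expresses these through ordinary partial derivatives of `K`
(`codazzi_of_flat`). This gives `B` as minus the curl of `K`, up to a transposition of the two
indices. The antisymmetric part of `curl K` is exactly the momentum constraint, so the order of the
indices does not matter (`magnetic_eq_neg_curl`).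

Let `X = K_k` be the proper conformal field and put `V_l = K_{lj} X^j`. By the product rule, `(curl
V)_i = - B_{ij} X^j + ε_{iml} K_{lj} ∂_m X^j`. The symmetric part of `∂_m X_j` is the pure trace
`x_k δ_{mj}` and drops out because `K` is symmetric. The antisymmetric part is an infinitesimal
rotation, and three-dimensional `ε` algebra turns its contribution into `P_{ij} R_k^j`; the term `K
δ_{ij}` of the momentum comes from this algebra. Hence `B X = P R_k - curl V` pointwise
(`sum_magnetic_mul_properConformal`).

For Stokes' theorem, the normal component of `curl V` is written as `∑_l {V_l, x_l}`, where `{a, b}`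
is `da ∧ db` divided by the area form. A partition of unity localises `a` in one chart, where `da ∧
db = d(a db)` has compact support and integrates to zero (`areaIntegral_bracket`,
`areaIntegral_curl`).

One complication is that the extrinsic curvature at `x` is defined in the chart around `Φ x`, which
moves with `x`. Before it can be differentiated, it must be shown not to depend on the chart. A
Koszul-type formula without Christoffel symbols serves for this (`two_mul_metric_cov_normal`,
`koszul_comp`), and it also yields symmetry and smoothness of `K`. -/

noncomputable section

set_option maxSynthPendingDepth 3

namespace FlatSlice

/-! ### Covariant derivative along a map -/

section Along

variable {V E : Type*} [NormedAddCommGroup V] [NormedSpace ℝ V]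
  [NormedAddCommGroup E] [NormedSpace ℝ E]

/-- Covariant derivative `∇_u a` at `x` of a vector field `a` along `φ`, for the connection with
Christoffel symbols `Γ`. -/
def cov (Γ : E → E →L[ℝ] E →L[ℝ] E) (φ a : V → E) (x u : V) : E :=
  fderiv ℝ a x u + Γ (φ x) (fderiv ℝ φ x u) (a x)

/-- Curvature `R(u, v) b` of the connection with Christoffel symbols `Γ`. -/
def curv (Γ : E → E →L[ℝ] E →L[ℝ] E) (y u v b : E) : E :=
  fderiv ℝ Γ y u v b - fderiv ℝ Γ y v u b + Γ y u (Γ y v b) - Γ y v (Γ y u b)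

/-- The connection `Γ` is compatible at `y` with the metric `G`. -/
def IsCompatAt (G : E → E →L[ℝ] E →L[ℝ] ℝ) (Γ : E → E →L[ℝ] E →L[ℝ] E) (y : E) : Prop :=
  ∀ u v w, fderiv ℝ G y u v w = G y (Γ y u v) w + G y v (Γ y u w)

variable {G : E → E →L[ℝ] E →L[ℝ] ℝ} {Γ : E → E →L[ℝ] E →L[ℝ] E} {φ a b : V → E} {x : V}

theorem hasFDerivAt_metric_apply (hG : DifferentiableAt ℝ G (φ x))
    (hφ : DifferentiableAt ℝ φ x) (ha : DifferentiableAt ℝ a x) (hb : DifferentiableAt ℝ b x)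
    (u : V) :
    fderiv ℝ (fun x => G (φ x) (a x) (b x)) x u
      = fderiv ℝ G (φ x) (fderiv ℝ φ x u) (a x) (b x) + G (φ x) (fderiv ℝ a x u) (b x)
        + G (φ x) (a x) (fderiv ℝ b x u) := by
  have h1 : HasFDerivAt (fun x => G (φ x)) ((fderiv ℝ G (φ x)).comp (fderiv ℝ φ x)) x :=
    hG.hasFDerivAt.comp x hφ.hasFDerivAt
  have h2 := (h1.clm_apply ha.hasFDerivAt).clm_apply hb.hasFDerivAt
  rw [h2.fderiv]
  simp
  ring

/-- Product rule for the metric. -/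
theorem fderiv_metric_apply (hG : DifferentiableAt ℝ G (φ x)) (hc : IsCompatAt G Γ (φ x))
    (hφ : DifferentiableAt ℝ φ x) (ha : DifferentiableAt ℝ a x) (hb : DifferentiableAt ℝ b x)
    (u : V) :
    fderiv ℝ (fun x => G (φ x) (a x) (b x)) x u
      = G (φ x) (cov Γ φ a x u) (b x) + G (φ x) (a x) (cov Γ φ b x u) := by
  rw [hasFDerivAt_metric_apply hG hφ ha hb, hc]
  simp only [cov, map_add, add_apply]
  ring

theorem fderiv_fderiv_apply (hφ : ContDiffAt ℝ 2 φ x) (u v : V) :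
    fderiv ℝ (fun x => fderiv ℝ φ x v) x u = fderiv ℝ (fderiv ℝ φ) x u v := by
  have h : DifferentiableAt ℝ (fderiv ℝ φ) x :=
    (hφ.fderiv_right (m := 1) (by norm_num)).differentiableAt (by norm_num)
  rw [(h.hasFDerivAt.clm_apply (hasFDerivAt_const v x)).fderiv]
  simp

theorem differentiableAt_fderiv_apply (hφ : ContDiffAt ℝ 2 φ x) (v : V) :
    DifferentiableAt ℝ (fun x => fderiv ℝ φ x v) x :=
  ((hφ.fderiv_right (m := 1) (by norm_num)).differentiableAt (by norm_num)).clm_apply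
    (differentiableAt_const v)

theorem fderiv_fderiv_symm (hφ : ContDiffAt ℝ 2 φ x) (u v : V) :
    fderiv ℝ (fderiv ℝ φ) x u v = fderiv ℝ (fderiv ℝ φ) x v u :=
  (hφ.isSymmSndFDerivAt (by simp)).eq u v

/-- A torsion-free connection. -/
theorem cov_fderiv_symm (hΓ : ∀ u v, Γ (φ x) u v = Γ (φ x) v u) (hφ : ContDiffAt ℝ 2 φ x)
    (u v : V) :
    cov Γ φ (fun x => fderiv ℝ φ x v) x u = cov Γ φ (fun x => fderiv ℝ φ x u) x v := by
  rw [cov, cov, fderiv_fderiv_apply hφ, fderiv_fderiv_apply hφ, fderiv_fderiv_symm hφ, hΓ]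

theorem differentiableAt_cov (hΓ : DifferentiableAt ℝ Γ (φ x)) (hφ : ContDiffAt ℝ 2 φ x)
    (ha : ContDiffAt ℝ 2 a x) (v : V) : DifferentiableAt ℝ (fun x => cov Γ φ a x v) x := by
  have h1 : DifferentiableAt ℝ (fun x => Γ (φ x)) x :=
    hΓ.comp x (hφ.differentiableAt (by norm_num))
  exact (differentiableAt_fderiv_apply ha v).add
    ((h1.clm_apply (differentiableAt_fderiv_apply hφ v)).clm_apply
      (ha.differentiableAt (by norm_num)))

theorem fderiv_cov (hΓ : DifferentiableAt ℝ Γ (φ x)) (hφ : ContDiffAt ℝ 2 φ x)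
    (ha : ContDiffAt ℝ 2 a x) (u v : V) :
    fderiv ℝ (fun x => cov Γ φ a x v) x u
      = fderiv ℝ (fderiv ℝ a) x u v
        + (fderiv ℝ Γ (φ x) (fderiv ℝ φ x u) (fderiv ℝ φ x v) (a x)
          + Γ (φ x) (fderiv ℝ (fderiv ℝ φ) x u v) (a x)
          + Γ (φ x) (fderiv ℝ φ x v) (fderiv ℝ a x u)) := by
  have hφ1 := hφ.differentiableAt (by norm_num)
  have ha1 := ha.differentiableAt (by norm_num)
  have h1 : HasFDerivAt (fun x => Γ (φ x)) ((fderiv ℝ Γ (φ x)).comp (fderiv ℝ φ x)) x :=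
    hΓ.hasFDerivAt.comp x hφ1.hasFDerivAt
  have h2 := (differentiableAt_fderiv_apply ha v).hasFDerivAt.add
    ((h1.clm_apply (differentiableAt_fderiv_apply hφ v).hasFDerivAt).clm_apply ha1.hasFDerivAt)
  have h3 : (fun x => cov Γ φ a x v)
    = (fun x => fderiv ℝ a x v) + fun x => Γ (φ x) (fderiv ℝ φ x v) (a x) := rfl
  rw [h3, h2.fderiv]
  simp only [add_apply, ContinuousLinearMap.comp_apply,
    ContinuousLinearMap.flip_apply, fderiv_fderiv_apply ha, fderiv_fderiv_apply hφ]
  abel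

/-- The commutator of covariant derivatives along a map is the curvature. -/
theorem cov_cov_sub (hΓ : DifferentiableAt ℝ Γ (φ x)) (hφ : ContDiffAt ℝ 2 φ x)
    (ha : ContDiffAt ℝ 2 a x) (u v : V) :
    cov Γ φ (fun x => cov Γ φ a x v) x u - cov Γ φ (fun x => cov Γ φ a x u) x v
      = curv Γ (φ x) (fderiv ℝ φ x u) (fderiv ℝ φ x v) (a x) := by
  have h (u v : V) : cov Γ φ (fun x => cov Γ φ a x v) x u = _ + _ :=
    congrArg₂ (· + ·) (fderiv_cov hΓ hφ ha u v) rfl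
  rw [h, h, fderiv_fderiv_symm ha u v, fderiv_fderiv_symm hφ u v]
  simp only [cov, curv, map_add]
  abel

/-- The curvature of a metric connection is skew. -/
theorem metric_curv_skew {y : E} (hG : ContDiffAt ℝ 2 G y) (hΓ : DifferentiableAt ℝ Γ y)
    (hc : ∀ᶠ y in nhds y, IsCompatAt G Γ y) (u v a b : E) :
    G y a (curv Γ y u v b) = - G y (curv Γ y u v a) b := by
  have hG1 := hG.differentiableAt (by norm_num)
  -- Compatibility is differentiated once more. The left side is symmetric in `u, v`, so
  -- antisymmetrising the right side leaves only the two curvature terms.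
  have key (u v : E) : fderiv ℝ (fderiv ℝ G) y u v a b
      = G y (Γ y u (Γ y v a)) b + G y (Γ y v a) (Γ y u b) + G y (fderiv ℝ Γ y u v a) b
        + (G y (Γ y u a) (Γ y v b) + G y a (Γ y u (Γ y v b)) + G y a (fderiv ℝ Γ y u v b)) := by
    have e1 : fderiv ℝ (fun y => fderiv ℝ G y v a b) y u = fderiv ℝ (fderiv ℝ G) y u v a b := by
      have h : DifferentiableAt ℝ (fderiv ℝ G) y :=
        (hG.fderiv_right (m := 1) (by norm_num)).differentiableAt (by norm_num)
      rw [(((h.hasFDerivAt.clm_apply (hasFDerivAt_const v y)).clm_apply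
        (hasFDerivAt_const a y)).clm_apply (hasFDerivAt_const b y)).fderiv]
      simp
    have e2 : (fun y => fderiv ℝ G y v a b)
        =ᶠ[nhds y] fun y => G y (Γ y v a) b + G y a (Γ y v b) := by
      filter_upwards [hc] with y hy using hy v a b
    have hΓ' (a : E) : HasFDerivAt (fun y => Γ y v a) _ y :=
      (hΓ.hasFDerivAt.clm_apply (hasFDerivAt_const v y)).clm_apply (hasFDerivAt_const a y)
    have h3 := ((hG1.hasFDerivAt.clm_apply (hΓ' a)).clm_apply (hasFDerivAt_const b y)).add
      ((hG1.hasFDerivAt.clm_apply (hasFDerivAt_const a y)).clm_apply (hΓ' b))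
    rw [← e1, e2.fderiv_eq]
    erw [h3.fderiv]
    have hcy := hc.self_of_nhds
    simp [hcy u]
    ring
  have h1 := key u v
  have h2 := key v u
  rw [fderiv_fderiv_symm hG u v, h2] at h1
  simp only [curv, map_add, map_sub, add_apply, sub_apply]
  linarith

/-- The tangential part of the second derivative vanishes if the induced metric is flat. -/
theorem metric_cov_fderiv_eq_zero (hG : DifferentiableAt ℝ G (φ x))
    (hGs : ∀ u v, G (φ x) u v = G (φ x) v u)
    (hΓ : ∀ u v, Γ (φ x) u v = Γ (φ x) v u) (hc : IsCompatAt G Γ (φ x)) (hφ : ContDiffAt ℝ 2 φ x)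
    (hflat : ∀ v w, fderiv ℝ (fun x => G (φ x) (fderiv ℝ φ x v) (fderiv ℝ φ x w)) x = 0)
    (u v w : V) : G (φ x) (cov Γ φ (fun x => fderiv ℝ φ x v) x u) (fderiv ℝ φ x w) = 0 := by
  -- The trilinear quantity is skew in `v, w` because the induced metric is constant, and symmetric
  -- in `u, v` because torsion vanishes. Such a quantity is zero, by the argument that makes the
  -- Levi-Civita connection unique.
  have key (u v w : V) : G (φ x) (cov Γ φ (fun x => fderiv ℝ φ x v) x u) (fderiv ℝ φ x w)
      = - G (φ x) (cov Γ φ (fun x => fderiv ℝ φ x w) x u) (fderiv ℝ φ x v) := by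
    have h := fderiv_metric_apply hG hc (hφ.differentiableAt (by norm_num))
      (differentiableAt_fderiv_apply hφ v) (differentiableAt_fderiv_apply hφ w) u
    rw [hflat, hGs (fderiv ℝ φ x v)] at h
    simp only [zero_apply] at h
    linarith
  have h1 := key u v w
  have h2 := key w u v
  have h3 := key v w u
  rw [cov_fderiv_symm hΓ hφ w u] at h2
  rw [cov_fderiv_symm hΓ hφ v w] at h3
  rw [cov_fderiv_symm hΓ hφ v u] at h3
  linarith

/-- The covariant derivative of a unit normal is tangential. -/
theorem metric_cov_normal_eq_zero (hG : DifferentiableAt ℝ G (φ x))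
    (hGs : ∀ u v, G (φ x) u v = G (φ x) v u) (hc : IsCompatAt G Γ (φ x))
    (hφ : DifferentiableAt ℝ φ x) (ha : DifferentiableAt ℝ a x)
    (hunit : fderiv ℝ (fun x => G (φ x) (a x) (a x)) x = 0) (u : V) :
    G (φ x) (cov Γ φ a x u) (a x) = 0 := by
  have h := fderiv_metric_apply hG hc hφ ha ha u
  rw [hunit, hGs (a x)] at h
  simp only [zero_apply] at h
  linarith

/-- Koszul-type formula for the second fundamental form. -/
theorem two_mul_metric_cov_normal (hG : DifferentiableAt ℝ G (φ x))
    (hGs : ∀ u v, G (φ x) u v = G (φ x) v u)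
    (hΓ : ∀ u v, Γ (φ x) u v = Γ (φ x) v u) (hc : IsCompatAt G Γ (φ x)) (hφ : ContDiffAt ℝ 2 φ x)
    (ha : DifferentiableAt ℝ a x)
    (horth : ∀ v, fderiv ℝ (fun x => G (φ x) (a x) (fderiv ℝ φ x v)) x = 0) (u v : V) :
    2 * G (φ x) (cov Γ φ a x u) (fderiv ℝ φ x v)
      = G (φ x) (fderiv ℝ a x u) (fderiv ℝ φ x v) + G (φ x) (fderiv ℝ a x v) (fderiv ℝ φ x u)
        + fderiv ℝ G (φ x) (a x) (fderiv ℝ φ x u) (fderiv ℝ φ x v) := by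
  -- Orthogonality moves the derivative from the normal to the tangent vector; absence of torsion
  -- then makes the form symmetric in `u, v`.
  have key (u v : V) : G (φ x) (cov Γ φ a x u) (fderiv ℝ φ x v)
      = - G (φ x) (a x) (cov Γ φ (fun x => fderiv ℝ φ x v) x u) := by
    have h := fderiv_metric_apply hG hc (hφ.differentiableAt (by norm_num)) ha
      (differentiableAt_fderiv_apply hφ v) u
    rw [horth] at h
    simp only [zero_apply] at h
    linarith
  have h1 : G (φ x) (cov Γ φ a x u) (fderiv ℝ φ x v)
      = G (φ x) (cov Γ φ a x v) (fderiv ℝ φ x u) := by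
    rw [key, key, cov_fderiv_symm hΓ hφ]
  rw [two_mul]
  nth_rw 2 [h1]
  rw [hc]
  simp only [cov, map_add, add_apply]
  rw [hΓ (a x), hΓ (a x), hGs (fderiv ℝ φ x u)]
  ring

/-- The right-hand side of the Koszul-type formula, hence the second fundamental form, does not
depend on the coordinates of the ambient space. -/
theorem koszul_comp {E' : Type*} [NormedAddCommGroup E'] [NormedSpace ℝ E'] {τ : E' → E}
    {ψ c : V → E'} {G' : E' → E' →L[ℝ] E' →L[ℝ] ℝ} (hGs : ∀ u v, G (τ (ψ x)) u v = G (τ (ψ x)) v u)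
    (hG : DifferentiableAt ℝ G (τ (ψ x))) (hτ : ContDiffAt ℝ 2 τ (ψ x))
    (hψ : DifferentiableAt ℝ ψ x) (hc : DifferentiableAt ℝ c x)
    (hG' : DifferentiableAt ℝ G' (ψ x))
    (hGG' : ∀ᶠ y in nhds (ψ x), ∀ v w, G' y v w = G (τ y) (fderiv ℝ τ y v) (fderiv ℝ τ y w))
    (hφ : φ =ᶠ[nhds x] τ ∘ ψ) (ha : a =ᶠ[nhds x] fun x => fderiv ℝ τ (ψ x) (c x)) (u v : V) :
    G (φ x) (fderiv ℝ a x u) (fderiv ℝ φ x v) + G (φ x) (fderiv ℝ a x v) (fderiv ℝ φ x u)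
        + fderiv ℝ G (φ x) (a x) (fderiv ℝ φ x u) (fderiv ℝ φ x v)
      = G' (ψ x) (fderiv ℝ c x u) (fderiv ℝ ψ x v) + G' (ψ x) (fderiv ℝ c x v) (fderiv ℝ ψ x u)
        + fderiv ℝ G' (ψ x) (c x) (fderiv ℝ ψ x u) (fderiv ℝ ψ x v) := by
  have hτ1 := hτ.differentiableAt (by norm_num)
  have hτ2 : DifferentiableAt ℝ (fderiv ℝ τ) (ψ x) :=
    (hτ.fderiv_right (m := 1) (by norm_num)).differentiableAt (by norm_num)
  have e1 (u : V) : fderiv ℝ φ x u = fderiv ℝ τ (ψ x) (fderiv ℝ ψ x u) := by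
    rw [hφ.fderiv_eq, fderiv_comp x hτ1 hψ]; rfl
  have e2 (u : V) : fderiv ℝ a x u = fderiv ℝ (fderiv ℝ τ) (ψ x) (fderiv ℝ ψ x u) (c x)
      + fderiv ℝ τ (ψ x) (fderiv ℝ c x u) := by
    have h1 : HasFDerivAt (fun x => fderiv ℝ τ (ψ x))
      ((fderiv ℝ (fderiv ℝ τ) (ψ x)).comp (fderiv ℝ ψ x)) x :=
      hτ2.hasFDerivAt.comp x hψ.hasFDerivAt
    rw [ha.fderiv_eq, (h1.clm_apply hc.hasFDerivAt).fderiv]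
    simp [add_comm]
  have e3 (v w : E') : fderiv ℝ G' (ψ x) (c x) v w
      = fderiv ℝ G (τ (ψ x)) (fderiv ℝ τ (ψ x) (c x)) (fderiv ℝ τ (ψ x) v) (fderiv ℝ τ (ψ x) w)
        + G (τ (ψ x)) (fderiv ℝ (fderiv ℝ τ) (ψ x) (c x) v) (fderiv ℝ τ (ψ x) w)
        + G (τ (ψ x)) (fderiv ℝ τ (ψ x) v) (fderiv ℝ (fderiv ℝ τ) (ψ x) (c x) w) := by
    have h1 : fderiv ℝ (fun y => G' y v w) (ψ x) (c x) = fderiv ℝ G' (ψ x) (c x) v w := by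
      rw [((hG'.hasFDerivAt.clm_apply (hasFDerivAt_const v _)).clm_apply
        (hasFDerivAt_const w _)).fderiv]
      simp
    have h2 : (fun y => G' y v w)
        =ᶠ[nhds (ψ x)] fun y => G (τ y) (fderiv ℝ τ y v) (fderiv ℝ τ y w) := by
      filter_upwards [hGG'] with y hy using hy v w
    rw [← h1, h2.fderiv_eq, hasFDerivAt_metric_apply hG hτ1 (differentiableAt_fderiv_apply hτ v)
      (differentiableAt_fderiv_apply hτ w), fderiv_fderiv_apply hτ, fderiv_fderiv_apply hτ]
  have e4 := hGG'.self_of_nhds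
  -- The second derivatives of `τ` produced by differentiating the transformed normal are the same
  -- as those produced by differentiating the pulled-back metric, once symmetry of the second
  -- derivative is used.
  rw [e3, e4, e4, e1, e1, e2, e2, hφ.self_of_nhds, ha.self_of_nhds,
    fderiv_fderiv_symm hτ (c x) (fderiv ℝ ψ x u), fderiv_fderiv_symm hτ (c x) (fderiv ℝ ψ x v),
    hGs (fderiv ℝ τ (ψ x) (fderiv ℝ ψ x u))]
  simp only [map_add, add_apply, Function.comp_apply]
  ring

/-- Codazzi equation. -/
theorem metric_curv_fderiv (hG : DifferentiableAt ℝ G (φ x)) (hc : IsCompatAt G Γ (φ x))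
    (hΓ : DifferentiableAt ℝ Γ (φ x)) (hφ : ContDiffAt ℝ 2 φ x) (ha : ContDiffAt ℝ 2 a x)
    (hcross : ∀ u v w,
      G (φ x) (cov Γ φ a x u) (cov Γ φ (fun x => fderiv ℝ φ x w) x v) = 0) (u v w : V) :
    G (φ x) (curv Γ (φ x) (fderiv ℝ φ x u) (fderiv ℝ φ x v) (a x)) (fderiv ℝ φ x w)
      = fderiv ℝ (fun x => G (φ x) (cov Γ φ a x v) (fderiv ℝ φ x w)) x u
        - fderiv ℝ (fun x => G (φ x) (cov Γ φ a x u) (fderiv ℝ φ x w)) x v := by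
  have h (u v : V) := fderiv_metric_apply hG hc (hφ.differentiableAt (by norm_num))
      (differentiableAt_cov hΓ hφ ha v) (differentiableAt_fderiv_apply hφ w) u
  rw [h, h, hcross, hcross, ← cov_cov_sub hΓ hφ ha]
  simp only [map_sub, sub_apply]
  ring

/-- Codazzi equation for a hypersurface with flat induced metric. -/
theorem codazzi_of_flat (hG : DifferentiableAt ℝ G (φ x))
    (hGs : ∀ u v, G (φ x) u v = G (φ x) v u)
    (hΓs : ∀ u v, Γ (φ x) u v = Γ (φ x) v u) (hc : IsCompatAt G Γ (φ x))
    (hΓ : DifferentiableAt ℝ Γ (φ x)) (hφ : ContDiffAt ℝ 2 φ x) (ha : ContDiffAt ℝ 2 a x)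
    (hflat : ∀ v w, fderiv ℝ (fun x => G (φ x) (fderiv ℝ φ x v) (fderiv ℝ φ x w)) x = 0)
    (hunit : fderiv ℝ (fun x => G (φ x) (a x) (a x)) x = 0)
    (hperp : ∀ w w', (∀ u, G (φ x) w (fderiv ℝ φ x u) = 0) → G (φ x) w' (a x) = 0 →
      G (φ x) w' w = 0) (u v w : V) :
    G (φ x) (fderiv ℝ φ x w) (curv Γ (φ x) (fderiv ℝ φ x u) (fderiv ℝ φ x v) (a x))
      = fderiv ℝ (fun x => G (φ x) (cov Γ φ a x v) (fderiv ℝ φ x w)) x u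
        - fderiv ℝ (fun x => G (φ x) (cov Γ φ a x u) (fderiv ℝ φ x w)) x v := by
  rw [hGs]
  -- The cross terms vanish: `∇_v ∂_w` is purely normal since the induced metric is flat, and `∇_u
  -- n` is purely tangential since `n` has constant length.
  refine metric_curv_fderiv hG hc hΓ hφ ha (fun u v w => hperp _ _ (fun u' => ?_) ?_) u v w
  · exact metric_cov_fderiv_eq_zero hG hGs hΓs hc hφ hflat v w u'
  · exact metric_cov_normal_eq_zero hG hGs hc (hφ.differentiableAt (by norm_num))
      (ha.differentiableAt (by norm_num)) hunit u

end Along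

/-! ### The antisymmetric symbol -/

section Symbol

/-- Multilinear expansion of the rows in the standard basis. The sum runs over all index maps, not
only permutations, to match index contractions with `ε`. -/
theorem det_eq_sum_symb {n : ℕ} (A : Matrix (Fin n) (Fin n) ℝ) :
    A.det = ∑ s : Fin n → Fin n, (∏ a, A a (s a)) * symb s := by
  have h (a : Fin n) : A a = ∑ b, A a b • (fun c => if b = c then (1 : ℝ) else 0) := by
    ext c; simp
  have h1 : A.det = Matrix.detRowAlternating.toMultilinearMap
      (fun a => ∑ b, A a b • (fun c => if b = c then (1 : ℝ) else 0)) :=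
    congrArg Matrix.det (funext h)
  rw [h1, MultilinearMap.map_sum]
  refine Finset.sum_congr rfl fun s _ => ?_
  rw [MultilinearMap.map_smul_univ]
  rfl

/-- Selecting rows is left multiplication by the 0-1 matrix whose determinant defines `symb s`. -/
theorem det_submatrix_eq_symb_mul {n : ℕ} (A : Matrix (Fin n) (Fin n) ℝ) (s : Fin n → Fin n) :
    (A.submatrix s id).det = symb s * A.det := by
  rw [symb, ← Matrix.det_mul]
  congr 1
  ext a b
  simp [Matrix.mul_apply]

theorem sum_fin_succ_arrow {n : ℕ} {α β : Type*} [Fintype α] [AddCommMonoid β]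
    (f : (Fin (n + 1) → α) → β) : ∑ s, f s = ∑ a, ∑ s : Fin n → α, f (Matrix.vecCons a s) := by
  rw [← Fintype.sum_prod_type' (f := fun a s => f (Matrix.vecCons a s))]
  exact (Fintype.sum_equiv (Fin.consEquiv fun _ => α) _ _ fun _ => rfl).symm

/-- The transformation law of the volume form under a change of frame, needed to evaluate `ε` on an
orthonormal frame. -/
theorem sum_symb_four (A : Matrix (Fin 4) (Fin 4) ℝ) (a b c d : Fin 4) :
    ∑ l, ∑ k, ∑ r, ∑ s, A a l * A b k * A c r * A d s * symb ![l, k, r, s]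
      = symb ![a, b, c, d] * A.det := by
  rw [← det_submatrix_eq_symb_mul, det_eq_sum_symb]
  simp only [sum_fin_succ_arrow, Fintype.sum_unique]
  refine Finset.sum_congr rfl fun l _ => Finset.sum_congr rfl fun k _ =>
    Finset.sum_congr rfl fun r _ => Finset.sum_congr rfl fun s _ => ?_
  simp only [Fin.prod_univ_four, Matrix.submatrix_apply, id]
  rfl

end Symbol

/-! ### Metric and connection as multilinear forms -/

section Forms

theorem e_apply {n : ℕ} (i j : Fin n) : (e i : Eu n) j = if j = i then 1 else 0 := by
  simp [e]

theorem sum_smul_e {n : ℕ} (v : Eu n) : ∑ i, v i • (e i : Eu n) = v := by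
  ext j
  simp [e_apply]

/-- The bilinear form with components `A`. -/
def metricForm (A : Matrix (Fin 4) (Fin 4) ℝ) : Eu 4 →L[ℝ] Eu 4 →L[ℝ] ℝ :=
  ∑ l, ∑ m, A l m • (EuclideanSpace.proj l : Eu 4 →L[ℝ] ℝ).smulRight
    (EuclideanSpace.proj m : Eu 4 →L[ℝ] ℝ)

/-- The vector-valued bilinear form with components `C`. -/
def connForm (C : Fin 4 → Fin 4 → Fin 4 → ℝ) : Eu 4 →L[ℝ] Eu 4 →L[ℝ] Eu 4 :=
  ∑ l, ∑ m, ∑ n, C l m n • (EuclideanSpace.proj m : Eu 4 →L[ℝ] ℝ).smulRight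
    ((EuclideanSpace.proj n : Eu 4 →L[ℝ] ℝ).smulRight (e l : Eu 4))

theorem metricForm_apply (A : Matrix (Fin 4) (Fin 4) ℝ) (v w : Eu 4) :
    metricForm A v w = ∑ l, ∑ m, A l m * v l * w m := by
  simp [metricForm, sum_apply, mul_assoc]

theorem connForm_apply (C : Fin 4 → Fin 4 → Fin 4 → ℝ) (v w : Eu 4) (l : Fin 4) :
    connForm C v w l = ∑ m, ∑ n, C l m n * v m * w n := by
  simp only [connForm, sum_apply, smul_apply, ContinuousLinearMap.smulRight_apply,
    PiLp.proj_apply, WithLp.ofLp_sum, Finset.sum_apply, PiLp.smul_apply, e_apply,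
    smul_eq_mul]
  rw [Finset.sum_eq_single l (fun b _ hb => by simp [hb.symm]) (by simp)]
  simp [mul_assoc]

variable {G : Eu 4 → Matrix (Fin 4) (Fin 4) ℝ} {C : Fin 4 → Fin 4 → Fin 4 → Eu 4 → ℝ} {y : Eu 4}

theorem contDiffAt_metricForm {k : WithTop ℕ∞} (h : ∀ l m, ContDiffAt ℝ k (fun y => G y l m) y) :
    ContDiffAt ℝ k (fun y => metricForm (G y)) y :=
  ContDiffAt.sum fun l _ => ContDiffAt.sum fun m _ => (h l m).smul contDiffAt_const

theorem differentiableAt_connForm (h : ∀ l m n, DifferentiableAt ℝ (C l m n) y) :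
    DifferentiableAt ℝ (fun y => connForm fun l m n => C l m n y) y :=
  DifferentiableAt.fun_sum fun l _ => DifferentiableAt.fun_sum fun m _ =>
    DifferentiableAt.fun_sum fun n _ => (h l m n).smul (differentiableAt_const _)

theorem fderiv_metricForm (h : ∀ l m, DifferentiableAt ℝ (fun y => G y l m) y) (u : Eu 4) :
    fderiv ℝ (fun y => metricForm (G y)) y u
      = metricForm (Matrix.of fun l m => fderiv ℝ (fun y => G y l m) y u) := by
  have h1 : HasFDerivAt (fun y => metricForm (G y)) _ y :=
    HasFDerivAt.fun_sum fun l _ => HasFDerivAt.fun_sum fun m _ =>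
      (h l m).hasFDerivAt.smul (hasFDerivAt_const _ y)
  rw [h1.fderiv]
  simp [metricForm, sum_apply]

theorem fderiv_connForm (h : ∀ l m n, DifferentiableAt ℝ (C l m n) y) (u : Eu 4) :
    fderiv ℝ (fun y => connForm fun l m n => C l m n y) y u
      = connForm fun l m n => fderiv ℝ (C l m n) y u := by
  have h1 : HasFDerivAt (fun y => connForm fun l m n => C l m n y) _ y :=
    HasFDerivAt.fun_sum fun l _ => HasFDerivAt.fun_sum fun m _ => HasFDerivAt.fun_sum fun n _ =>
      (h l m n).hasFDerivAt.smul (hasFDerivAt_const _ y)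
  rw [h1.fderiv]
  simp [connForm, sum_apply]

end Forms

/-! ### The Levi-Civita connection in coordinates: symmetry, compatibility, curvature components -/

section LeviCivita

variable {G : Eu 4 → Matrix (Fin 4) (Fin 4) ℝ} {y : Eu 4}

/-- The Levi-Civita connection of the metric components `G`. -/
def leviCivita (G : Eu 4 → Matrix (Fin 4) (Fin 4) ℝ) (y : Eu 4) : Eu 4 →L[ℝ] Eu 4 →L[ℝ] Eu 4 :=
  connForm fun l m n => christoffel G l m n y

theorem metricForm_symm (hs : ∀ l m, G y l m = G y m l) (v w : Eu 4) :
    metricForm (G y) v w = metricForm (G y) w v := by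
  rw [metricForm_apply, metricForm_apply, Finset.sum_comm]
  refine Finset.sum_congr rfl fun l _ => Finset.sum_congr rfl fun m _ => ?_
  rw [hs]; ring

theorem christoffel_symm (hs : ∀ᶠ y in nhds y, ∀ l m, G y l m = G y m l) (l m n : Fin 4) :
    christoffel G l m n y = christoffel G l n m y := by
  unfold christoffel
  congr 1
  refine Finset.sum_congr rfl fun s _ => ?_
  have h (a b c : Fin 4) : pd a (fun z => G z b c) y = pd a (fun z => G z c b) y := by
    unfold pd
    rw [Filter.EventuallyEq.fderiv_eq (hs.mono fun z hz => hz b c)]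
  rw [h s m n]
  ring

theorem leviCivita_symm (hs : ∀ᶠ y in nhds y, ∀ l m, G y l m = G y m l) (v w : Eu 4) :
    leviCivita G y v w = leviCivita G y w v := by
  ext l
  rw [leviCivita, connForm_apply, connForm_apply, Finset.sum_comm]
  refine Finset.sum_congr rfl fun m _ => Finset.sum_congr rfl fun n _ => ?_
  rw [christoffel_symm hs]; ring

/-- Lowering the upper index cancels the inverse metric and leaves the Christoffel symbols of the
first kind. -/
theorem sum_mul_christoffel (hdet : (G y).det ≠ 0) (a m n : Fin 4) :
    ∑ r, G y a r * christoffel G r m n y = (1 / 2) *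
      (pd m (fun z => G z a n) y + pd n (fun z => G z a m) y - pd a (fun z => G z m n) y) := by
  have h : ∀ s, ∑ r, G y a r * (G y)⁻¹ r s = if a = s then 1 else 0 := by
    intro s
    rw [← Matrix.mul_apply, Matrix.mul_nonsing_inv _ (Ne.isUnit hdet), Matrix.one_apply]
  simp only [christoffel, Finset.mul_sum]
  rw [Finset.sum_comm]
  have h2 : ∀ s, ∑ r, G y a r * (1 / 2 * ((G y)⁻¹ r s *
        (pd m (fun z => G z s n) y + pd n (fun z => G z s m) y - pd s (fun z => G z m n) y)))
      = (if a = s then 1 else 0) * (1 / 2 *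
        (pd m (fun z => G z s n) y + pd n (fun z => G z s m) y - pd s (fun z => G z m n) y)) := by
    intro s
    rw [← h s, Finset.sum_mul]
    refine Finset.sum_congr rfl fun r _ => by ring
  simp only [h2]
  simp

theorem sum_apply_e {F : Type*} [NormedAddCommGroup F] [NormedSpace ℝ F] {n : ℕ}
    (f : Eu n →L[ℝ] F) (v : Eu n) : f v = ∑ i, v i • f (e i) := by
  conv_lhs => rw [← sum_smul_e v, map_sum]
  simp

theorem metricForm_e (A : Matrix (Fin 4) (Fin 4) ℝ) (a b : Fin 4) :
    metricForm A (e a) (e b) = A a b := by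
  simp [metricForm_apply, e_apply]

theorem connForm_e (C : Fin 4 → Fin 4 → Fin 4 → ℝ) (l m n : Fin 4) :
    connForm C (e m) (e n) l = C l m n := by
  simp [connForm_apply, e_apply]

theorem metricForm_e_left (A : Matrix (Fin 4) (Fin 4) ℝ) (a : Fin 4) (w : Eu 4) :
    metricForm A (e a) w = ∑ r, A a r * w r := by
  simp [metricForm_apply, e_apply]

/-- On basis vectors this is the sum of two Christoffel symbols of the first kind, in which all but
one derivative of the metric cancel. Linearity then extends it one slot at a time. -/
theorem isCompatAt_leviCivita (hG : ∀ l m, DifferentiableAt ℝ (fun y => G y l m) y)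
    (hs : ∀ᶠ y in nhds y, ∀ l m, G y l m = G y m l) (hdet : (G y).det ≠ 0) :
    IsCompatAt (fun y => metricForm (G y)) (leviCivita G) y := by
  have hpd (a b c : Fin 4) : pd a (fun z => G z b c) y = pd a (fun z => G z c b) y := by
    unfold pd
    rw [Filter.EventuallyEq.fderiv_eq (hs.mono fun z hz => hz b c)]
  have hsy := metricForm_symm hs.self_of_nhds
  have key (s a b : Fin 4) : fderiv ℝ (fun y => metricForm (G y)) y (e s) (e a) (e b)
      = metricForm (G y) (leviCivita G y (e s) (e a)) (e b)
        + metricForm (G y) (e a) (leviCivita G y (e s) (e b)) := by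
    rw [fderiv_metricForm hG, metricForm_e, hsy _ (e b), metricForm_e_left, metricForm_e_left]
    simp only [leviCivita, connForm_e, sum_mul_christoffel hdet, Matrix.of_apply]
    rw [hpd a b s, hpd b a s, hpd s b a]
    simp only [pd]
    ring
  intro u v w
  have h1 (s a : Fin 4) : fderiv ℝ (fun y => metricForm (G y)) y (e s) (e a) w
      = metricForm (G y) (leviCivita G y (e s) (e a)) w
        + metricForm (G y) (e a) (leviCivita G y (e s) w) := by
    rw [sum_apply_e (fderiv ℝ (fun y => metricForm (G y)) y (e s) (e a)) w,
      sum_apply_e (metricForm (G y) (leviCivita G y (e s) (e a))) w,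
      sum_apply_e (leviCivita G y (e s)) w, map_sum, ← Finset.sum_add_distrib]
    refine Finset.sum_congr rfl fun b _ => ?_
    rw [key, map_smul, smul_add]
  have h2 (s : Fin 4) : fderiv ℝ (fun y => metricForm (G y)) y (e s) v w
      = metricForm (G y) (leviCivita G y (e s) v) w
        + metricForm (G y) v (leviCivita G y (e s) w) := by
    rw [sum_apply_e (fderiv ℝ (fun y => metricForm (G y)) y (e s)) v,
      sum_apply_e (metricForm (G y)) v,
      sum_apply_e (leviCivita G y (e s)) v, map_sum, sum_apply, sum_apply, sum_apply,
      ← Finset.sum_add_distrib]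
    refine Finset.sum_congr rfl fun b _ => ?_
    rw [smul_apply, h1, map_smul, smul_apply, smul_apply, smul_add]
  rw [sum_apply_e (fderiv ℝ (fun y => metricForm (G y)) y) u, sum_apply_e (leviCivita G y) u,
    sum_apply, sum_apply, sum_apply, sum_apply, map_sum, map_sum, sum_apply,
    ← Finset.sum_add_distrib]
  refine Finset.sum_congr rfl fun b _ => ?_
  simp only [smul_apply, map_smul, h2, smul_add]

theorem differentiableAt_christoffel (hG : ∀ l m, ContDiffAt ℝ 2 (fun y => G y l m) y)
    (hdet : (G y).det ≠ 0) (l m n : Fin 4) : DifferentiableAt ℝ (christoffel G l m n) y := by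
  have hpd (a b c : Fin 4) : DifferentiableAt ℝ (pd a fun z => G z b c) y :=
    differentiableAt_fderiv_apply (hG b c) (e a)
  -- Stated for an arbitrary matrix function because Cramer's rule needs it twice: for the
  -- determinant of `G`, and for the row-updated determinants that form the adjugate.
  have hpoly : ∀ (f : Eu 4 → Matrix (Fin 4) (Fin 4) ℝ),
      (∀ l m, DifferentiableAt ℝ (fun y => f y l m) y) →
      DifferentiableAt ℝ (fun y => (f y).det) y := by
    intro f hf
    simp only [Matrix.det_apply]
    refine DifferentiableAt.fun_sum fun s _ => DifferentiableAt.const_smul ?_ _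
    exact (HasFDerivAt.finsetProd fun i _ => (hf (s i) i).hasFDerivAt).differentiableAt
  have hinv (l s : Fin 4) : DifferentiableAt ℝ (fun y => (G y)⁻¹ l s) y := by
    simp only [Matrix.inv_def, Matrix.smul_apply, Ring.inverse_eq_inv', smul_eq_mul,
      Matrix.adjugate_apply]
    refine (((hpoly G fun l m => (hG l m).differentiableAt (by norm_num))).inv hdet).mul ?_
    refine hpoly _ fun a b => ?_
    by_cases h : a = s
    · subst h; simp
    · simp only [Matrix.updateRow_ne h]
      exact (hG a b).differentiableAt (by norm_num)
  refine DifferentiableAt.const_mul (DifferentiableAt.fun_sum fun s _ => ?_) _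
  exact (hinv l s).mul (((hpd _ _ _).add (hpd _ _ _)).sub (hpd _ _ _))

theorem differentiableAt_leviCivita (hG : ∀ l m, ContDiffAt ℝ 2 (fun y => G y l m) y)
    (hdet : (G y).det ≠ 0) : DifferentiableAt ℝ (leviCivita G) y :=
  differentiableAt_connForm (differentiableAt_christoffel hG hdet)

/-- The bridge between the index definition of the Riemann tensor and the operator form in which
Codazzi is proved. -/
theorem curv_leviCivita_e (hG : ∀ l m, ContDiffAt ℝ 2 (fun y => G y l m) y)
    (hdet : (G y).det ≠ 0) (r s m n : Fin 4) :
    curv (leviCivita G) y (e m) (e n) (e s) r = riemannUp G r s m n y := by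
  have h (m n s : Fin 4) : fderiv ℝ (leviCivita G) y (e m) (e n) (e s) r
      = pd m (christoffel G r n s) y := by
    unfold leviCivita
    rw [fderiv_connForm (differentiableAt_christoffel hG hdet), connForm_e, pd]
  have h2 (m n s : Fin 4) : leviCivita G y (e m) (leviCivita G y (e n) (e s)) r
      = ∑ l, christoffel G r m l y * christoffel G l n s y := by
    simp only [leviCivita]
    rw [connForm_apply]
    simp only [connForm_e]
    simp [e_apply]
  simp only [curv, PiLp.add_apply, PiLp.sub_apply, h, h2, riemannUp, Finset.sum_sub_distrib]
  ring

end LeviCivita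

theorem sum_sum_comm {α β : Type*} [Fintype α] [Fintype β] (f : α → α → β → β → ℝ) :
    ∑ a, ∑ b, ∑ c, ∑ d, f a b c d = ∑ c, ∑ d, ∑ a, ∑ b, f a b c d := by
  have h := Finset.sum_comm (s := (Finset.univ : Finset (α × α)))
    (t := (Finset.univ : Finset (β × β))) (f := fun p q => f p.1 p.2 q.1 q.2)
  simpa only [Fintype.sum_prod_type] using h

/-! ### Orthonormal frames -/

section Frame

/-- Signature of an orthonormal frame whose last vector is timelike. -/
def eta (a : Fin 4) : ℝ := if a = 3 then -1 else 1

theorem eta_mul_self (a : Fin 4) : eta a * eta a = 1 := by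
  unfold eta; split_ifs <;> norm_num

/-- `F` is orthonormal for the bilinear form with components `A`, with timelike last vector. -/
def IsFrame (A : Matrix (Fin 4) (Fin 4) ℝ) (F : Fin 4 → Eu 4) : Prop :=
  ∀ a b, metricForm A (F a) (F b) = if a = b then eta a else 0

variable {A : Matrix (Fin 4) (Fin 4) ℝ} {F : Fin 4 → Eu 4}

/-- The matrix whose columns are the vectors of the frame. -/
def frameMatrix (F : Fin 4 → Eu 4) : Matrix (Fin 4) (Fin 4) ℝ := Matrix.of fun m a => F a m

/-- The matrix whose rows are the covectors dual to the frame under the metric. -/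
def coframeMatrix (A : Matrix (Fin 4) (Fin 4) ℝ) (F : Fin 4 → Eu 4) :
    Matrix (Fin 4) (Fin 4) ℝ := (frameMatrix F).transpose * A

theorem coframeMatrix_apply (a l : Fin 4) :
    coframeMatrix A F a l = metricForm A (F a) (e l) := by
  simp [coframeMatrix, frameMatrix, Matrix.mul_apply, metricForm_apply, e_apply, mul_comm]

theorem IsFrame.coframe_mul_frame (h : IsFrame A F) :
    coframeMatrix A F * frameMatrix F = Matrix.diagonal eta := by
  ext a b
  rw [Matrix.diagonal_apply, ← h a b, sum_apply_e (metricForm A (F a)) (F b), Matrix.mul_apply]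
  refine Finset.sum_congr rfl fun l _ => ?_
  rw [coframeMatrix_apply, smul_eq_mul, mul_comm]
  rfl

theorem det_diagonal_eta : (Matrix.diagonal eta).det = -1 := by
  simp [eta]

theorem IsFrame.det_mul_det (h : IsFrame A F) :
    (frameMatrix F).det * (coframeMatrix A F).det = -1 := by
  rw [mul_comm, ← Matrix.det_mul, h.coframe_mul_frame, det_diagonal_eta]

/-- Orthonormality is the matrix equation `Fᵀ A F = diag(1, 1, 1, -1)`; this is its determinant. -/
theorem IsFrame.det_sq_mul_det (h : IsFrame A F) :
    (frameMatrix F).det ^ 2 * A.det = -1 := by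
  rw [← h.det_mul_det, coframeMatrix, Matrix.det_mul, Matrix.det_transpose]
  ring

theorem IsFrame.det_ne_zero (h : IsFrame A F) : A.det ≠ 0 := by
  intro h0
  have := h.det_sq_mul_det
  rw [h0] at this
  norm_num at this

/-- Since `|det A| = (det F)⁻²`, the oriented density `± 1 / √|det g|` is simply `det F`. This
removes both the square root and the chart orientation from the antisymmetric tensor. -/
theorem IsFrame.sign_div_sqrt (h : IsFrame A F) :
    Real.sign (frameMatrix F).det / √|A.det| = (frameMatrix F).det := by
  have h1 := h.det_sq_mul_det
  set d := (frameMatrix F).det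
  have hd : d ≠ 0 := by rintro h0; rw [h0] at h1; norm_num at h1
  have hA : |A.det| = (|d|⁻¹) ^ 2 := by
    have : A.det = - (d ^ 2)⁻¹ := by field_simp; linarith
    rw [this, abs_neg, abs_inv, abs_pow, inv_pow]
  rw [hA, Real.sqrt_sq (by positivity), div_inv_eq_mul]
  rcases lt_or_gt_of_ne hd with h2 | h2
  · rw [Real.sign_of_neg h2, abs_of_neg h2]; ring
  · rw [Real.sign_of_pos h2, abs_of_pos h2]; ring

theorem IsFrame.expand (h : IsFrame A F) (v : Eu 4) :
    v = ∑ a, (eta a * metricForm A (F a) v) • F a := by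
  -- Orthonormality says that the coframe is a left inverse up to `eta`; for square matrices it is
  -- then also a right inverse, which is completeness of the frame.
  have h1 : frameMatrix F * (Matrix.diagonal eta * coframeMatrix A F) = 1 := by
    rw [mul_eq_one_comm, Matrix.mul_assoc, h.coframe_mul_frame,
      Matrix.diagonal_mul_diagonal]
    simp [eta_mul_self]
  have h2 (l : Fin 4) : (e l : Eu 4) = ∑ a, (eta a * metricForm A (F a) (e l)) • F a := by
    ext m
    have h3 := congrFun (congrFun h1 m) l
    rw [Matrix.mul_apply, Matrix.one_apply] at h3
    rw [e_apply, ← h3]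
    simp [frameMatrix, coframeMatrix_apply, mul_comm]
  have h4 (a : Fin 4) : metricForm A (F a) v = ∑ l, v l * metricForm A (F a) (e l) := by
    rw [sum_apply_e (metricForm A (F a)) v]; rfl
  conv_lhs => rw [← sum_smul_e v]
  simp only [h4, Finset.mul_sum, Finset.sum_smul]
  rw [Finset.sum_comm]
  refine Finset.sum_congr rfl fun l _ => ?_
  conv_lhs => rw [h2 l]
  rw [Finset.smul_sum]
  refine Finset.sum_congr rfl fun a _ => ?_
  rw [smul_smul]
  ring_nf

theorem IsFrame.metricForm_eq (h : IsFrame A F) (v w : Eu 4)  :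
    metricForm A v w = ∑ a, eta a * metricForm A v (F a) * metricForm A (F a) w := by
  conv_lhs => rw [h.expand w, map_sum]
  simp only [map_smul, smul_eq_mul]
  exact Finset.sum_congr rfl fun a _ => by ring

/-- A trace can be taken in any frame; this allows the Ricci contraction to be split into tangential
and normal parts. -/
theorem IsFrame.trace_eq (h : IsFrame A F) (T : Eu 4 →L[ℝ] Eu 4) :
    ∑ r, T (e r) r = ∑ a, eta a * metricForm A (F a) (T (F a)) := by
  have h1 (r : Fin 4) : T (e r) r = ∑ a, eta a * (T (F a) r * metricForm A (F a) (e r)) := by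
    conv_lhs => rw [h.expand (e r), map_sum]
    simp only [map_smul, WithLp.ofLp_sum, Finset.sum_apply, PiLp.smul_apply, smul_eq_mul]
    exact Finset.sum_congr rfl fun a _ => by ring
  simp only [h1]
  rw [Finset.sum_comm]
  refine Finset.sum_congr rfl fun a _ => ?_
  rw [sum_apply_e (metricForm A (F a)) (T (F a)), Finset.mul_sum]
  rfl

/-- Contraction of a bilinear form with the volume form, in terms of a frame. -/
theorem IsFrame.sum_symb (h : IsFrame A F) (Ω : Eu 4 →ₗ[ℝ] Eu 4 →ₗ[ℝ] ℝ) (c d : Fin 4) :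
    ∑ l, ∑ k, Ω (e l) (e k) * ∑ r, ∑ s, (frameMatrix F).det * symb ![l, k, r, s]
        * coframeMatrix A F c r * coframeMatrix A F d s
      = - ∑ a, ∑ b, eta a * eta b * Ω (F a) (F b) * symb ![a, b, c, d] := by
  have h1 (l k : Fin 4) : Ω (e l) (e k) = ∑ a, ∑ b, eta a * eta b * Ω (F a) (F b) *
      (coframeMatrix A F a l * coframeMatrix A F b k) := by
    conv_lhs => rw [h.expand (e l), h.expand (e k)]
    simp only [map_sum, map_smul, LinearMap.sum_apply, LinearMap.smul_apply, smul_eq_mul,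
      Finset.mul_sum, coframeMatrix_apply]
    rw [Finset.sum_comm]
    exact Finset.sum_congr rfl fun a _ => Finset.sum_congr rfl fun b _ => by ring
  have h2 (a b : Fin 4) : ∑ l, ∑ k, coframeMatrix A F a l * coframeMatrix A F b k *
      ∑ r, ∑ s, (frameMatrix F).det * symb ![l, k, r, s]
        * coframeMatrix A F c r * coframeMatrix A F d s = - symb ![a, b, c, d] := by
    have h3 := sum_symb_four (coframeMatrix A F) a b c d
    have h4 : - symb ![a, b, c, d]
      -- The minus sign is the Lorentzian signature: the determinants of frame and coframe multiply
      -- to `-1`.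
      = (frameMatrix F).det * (symb ![a, b, c, d] * (coframeMatrix A F).det) := by
      linear_combination (- symb ![a, b, c, d]) * h.det_mul_det
    rw [h4, ← h3]
    simp only [Finset.mul_sum]
    exact Finset.sum_congr rfl fun l _ => Finset.sum_congr rfl fun k _ =>
      Finset.sum_congr rfl fun r _ => Finset.sum_congr rfl fun s _ => by ring
  have h5 : ∑ a, ∑ b, eta a * eta b * Ω (F a) (F b) * symb ![a, b, c, d]
    = - ∑ a, ∑ b, eta a * eta b * Ω (F a) (F b) * (∑ l, ∑ k, coframeMatrix A F a l *
      coframeMatrix A F b k * ∑ r, ∑ s, (frameMatrix F).det * symb ![l, k, r, s]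
        * coframeMatrix A F c r * coframeMatrix A F d s) := by
    simp only [h2, mul_neg, Finset.sum_neg_distrib, neg_neg]
  rw [h5, neg_neg]
  simp only [h1]
  generalize hY : (fun l k : Fin 4 => ∑ r, ∑ s, (frameMatrix F).det * symb ![l, k, r, s]
        * coframeMatrix A F c r * coframeMatrix A F d s) = Y
  have hY' (l k : Fin 4) : (∑ r, ∑ s, (frameMatrix F).det * symb ![l, k, r, s]
        * coframeMatrix A F c r * coframeMatrix A F d s) = Y l k := by rw [← hY]
  simp only [hY', Finset.mul_sum, Finset.sum_mul]
  rw [← sum_sum_comm]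
  exact Finset.sum_congr rfl fun a _ => Finset.sum_congr rfl fun b _ =>
    Finset.sum_congr rfl fun l _ => Finset.sum_congr rfl fun k _ => by ring

end Frame

/-! ### Values of the symbol -/

section SymbolValues

/-- Over the integers the finitely many values of the symbol can be checked by `decide`. -/
theorem symb_eq_intCast {n : ℕ} (s : Fin n → Fin n) :
    symb s = (((Matrix.of fun a b => if s a = b then (1 : ℤ) else 0).det : ℤ) : ℝ) := by
  rw [symb, Int.cast_det]
  congr 1
  ext a b
  by_cases h : s a = b <;> simp [h]

/-- The normal index `3` stands in third place; one transposition moves it to the end, which gives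
the sign. -/
theorem symb_four_spatial (a b c : Fin 3) :
    symb ![a.castSucc, b.castSucc, 3, c.castSucc] = - symb ![a, b, c] := by
  have h : ∀ a b c : Fin 3,
      (Matrix.of fun i j => if ![a.castSucc, b.castSucc, 3, c.castSucc] i = j
        then (1 : ℤ) else 0).det
      = - (Matrix.of fun i j => if ![a, b, c] i = j then (1 : ℤ) else 0).det := by decide +kernel
  rw [symb_eq_intCast, symb_eq_intCast, h]
  simp

theorem symb_four_left (b c : Fin 4) : symb ![3, b, 3, c] = 0 :=
  Matrix.det_zero_of_row_eq (i := 0) (j := 2) (by decide) rfl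

theorem symb_four_right (a c : Fin 4) : symb ![a, 3, 3, c] = 0 :=
  Matrix.det_zero_of_row_eq (i := 1) (j := 2) (by decide) rfl

end SymbolValues

/-! ### Curvature as a trilinear map -/

section CurvForm

variable {G : Eu 4 → Matrix (Fin 4) (Fin 4) ℝ} {y : Eu 4}

/-- The curvature of the connection `Γ` as a trilinear map. -/
def curvForm {E : Type*} [NormedAddCommGroup E] [NormedSpace ℝ E]
    (Γ : E → E →L[ℝ] E →L[ℝ] E) (y : E) : E →L[ℝ] E →L[ℝ] E →L[ℝ] E :=
  fderiv ℝ Γ y - (fderiv ℝ Γ y).flip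
    + ((ContinuousLinearMap.compL ℝ E E E).bilinearComp (Γ y) (Γ y)
      - ((ContinuousLinearMap.compL ℝ E E E).bilinearComp (Γ y) (Γ y)).flip)

theorem curvForm_apply {E : Type*} [NormedAddCommGroup E] [NormedSpace ℝ E]
    (Γ : E → E →L[ℝ] E →L[ℝ] E) (y u v b : E) : curvForm Γ y u v b = curv Γ y u v b := by
  simp [curvForm, curv]
  abel

/-- Ricci as the trace of `u ↦ R(u, v) β`, a form that can be evaluated in an orthonormal frame. -/
theorem sum_ricci (hG : ∀ l m, ContDiffAt ℝ 2 (fun y => G y l m) y) (hdet : (G y).det ≠ 0)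
    (β v : Eu 4) : ∑ b, ∑ n, β b * v n * ricci G b n y
      = ∑ r, curv (leviCivita G) y (e r) v β r := by
  have h (r : Fin 4) : curv (leviCivita G) y (e r) v β r
      = ∑ b, ∑ n, β b * v n * riemannUp G r b r n y := by
    rw [← curvForm_apply, sum_apply_e (curvForm (leviCivita G) y (e r) v) β,
      sum_apply_e (curvForm (leviCivita G) y (e r)) v]
    simp only [sum_apply, smul_apply, Finset.smul_sum, WithLp.ofLp_sum, Finset.sum_apply,
      PiLp.smul_apply, smul_eq_mul, curvForm_apply, curv_leviCivita_e hG hdet, mul_assoc]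
  simp only [h, ricci, Finset.mul_sum]
  symm
  rw [Finset.sum_comm]
  exact Finset.sum_congr rfl fun b _ => Finset.sum_comm

theorem sum_riemann (hG : ∀ l m, ContDiffAt ℝ 2 (fun y => G y l m) y) (hdet : (G y).det ≠ 0)
    (v w : Eu 4) (l k : Fin 4) : ∑ a, ∑ m, riemann G a m l k y * v a * w m
      = metricForm (G y) v (curv (leviCivita G) y (e l) (e k) w) := by
  rw [metricForm_apply]
  refine Finset.sum_congr rfl fun a _ => ?_
  have h (r : Fin 4) : curv (leviCivita G) y (e l) (e k) w r
      = ∑ m, w m * riemannUp G r m l k y := by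
    rw [← curvForm_apply, sum_apply_e (curvForm (leviCivita G) y (e l) (e k)) w]
    simp only [WithLp.ofLp_sum, Finset.sum_apply,
      PiLp.smul_apply, smul_eq_mul, curvForm_apply, curv_leviCivita_e hG hdet]
  simp only [h, riemann, Finset.mul_sum, Finset.sum_mul]
  rw [Finset.sum_comm]
  exact Finset.sum_congr rfl fun m _ => Finset.sum_congr rfl fun r _ => by ring

/-- The vacuum equations say that the Ricci tensor vanishes. -/
theorem ricci_eq_zero_of_vacuum (hs : ∀ l m, G y l m = G y m l) (hdet : (G y).det ≠ 0)
    (hvac : ∀ m n, ricci G m n y - (1 / 2) * scalarCurv G y * G y m n = 0) :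
    scalarCurv G y = 0 ∧ ∀ m n, ricci G m n y = 0 := by
  have h0 : scalarCurv G y = 0 := by
    -- The trace of the vacuum equations in dimension four reads `R = (1/2) R · 4`, hence `R = 0`.
    have h1 : scalarCurv G y = ∑ b, ∑ n, (G y)⁻¹ b n * (1 / 2 * scalarCurv G y * G y b n) := by
      conv_lhs => rw [scalarCurv]
      refine Finset.sum_congr rfl fun b _ => Finset.sum_congr rfl fun n _ => ?_
      rw [← sub_eq_zero.mp (hvac b n)]
    have h2 (b : Fin 4) : ∑ n, (G y)⁻¹ b n * G y b n = 1 := by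
      have h3 := congrFun (congrFun (Matrix.nonsing_inv_mul (G y) (Ne.isUnit hdet)) b) b
      rw [Matrix.mul_apply, Matrix.one_apply_eq] at h3
      rw [← h3]
      exact Finset.sum_congr rfl fun n _ => by rw [hs b n]
    have h4 : ∑ b, ∑ n, (G y)⁻¹ b n * (1 / 2 * scalarCurv G y * G y b n)
        = 1 / 2 * scalarCurv G y * ∑ b : Fin 4, ∑ n, (G y)⁻¹ b n * G y b n := by
      simp only [Finset.mul_sum]
      exact Finset.sum_congr rfl fun b _ => Finset.sum_congr rfl fun n _ => by ring
    rw [h4] at h1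
    simp only [h2] at h1
    simp at h1
    linarith
  refine ⟨h0, fun m n => ?_⟩
  have := hvac m n
  rw [h0] at this
  linarith

theorem weyl_eq_riemann (h0 : scalarCurv G y = 0) (h : ∀ m n, ricci G m n y = 0)
    (a b m n : Fin 4) : weyl G a b m n y = riemann G a b m n y := by
  simp [weyl, h0, h]

end CurvForm

/-! ### Flat slices in a chart -/

section Slice

/-- A slice `φ` with unit normal `a` and flat induced metric near `x`, in coordinates in which the
ambient metric has components `G`. -/
structure IsFlatSliceAt (G : Eu 4 → Matrix (Fin 4) (Fin 4) ℝ) (φ a : Eu 3 → Eu 4) (x : Eu 3) :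
    Prop where
  metric : ∀ l m, ContDiffAt ℝ ∞ (fun y => G y l m) (φ x)
  slice : ContDiffAt ℝ ∞ φ x
  normal : ContDiffAt ℝ ∞ a x
  symm : ∀ᶠ y in nhds (φ x), ∀ l m, G y l m = G y m l
  flat : ∀ᶠ x in nhds x, ∀ i j : Fin 3,
    metricForm (G (φ x)) (fderiv ℝ φ x (e i)) (fderiv ℝ φ x (e j)) = if i = j then 1 else 0
  unit : ∀ᶠ x in nhds x, metricForm (G (φ x)) (a x) (a x) = -1
  orth : ∀ᶠ x in nhds x, ∀ i : Fin 3, metricForm (G (φ x)) (a x) (fderiv ℝ φ x (e i)) = 0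

/-- The frame formed by the coordinate vectors of the slice and its normal. -/
def sliceFrame (φ a : Eu 3 → Eu 4) (x : Eu 3) : Fin 4 → Eu 4 :=
  ![fderiv ℝ φ x (e 0), fderiv ℝ φ x (e 1), fderiv ℝ φ x (e 2), a x]

/-- Second fundamental form of a slice in coordinates. -/
def sliceExtrinsic (G : Eu 4 → Matrix (Fin 4) (Fin 4) ℝ) (φ a : Eu 3 → Eu 4) (i j : Fin 3)
    (x : Eu 3) : ℝ :=
  - metricForm (G (φ x)) (cov (leviCivita G) φ a x (e i)) (fderiv ℝ φ x (e j))

variable {G : Eu 4 → Matrix (Fin 4) (Fin 4) ℝ} {φ a : Eu 3 → Eu 4} {x : Eu 3}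

theorem sliceFrame_castSucc (i : Fin 3) :
    sliceFrame φ a x i.castSucc = fderiv ℝ φ x (e i) := by
  fin_cases i <;> rfl

theorem eta_castSucc (i : Fin 3) : eta i.castSucc = 1 := if_neg (Fin.castSucc_ne_last i)

theorem sliceFrame_last : sliceFrame φ a x 3 = a x := rfl

theorem sliceFrame_last' : sliceFrame φ a x (Fin.last 3) = a x := rfl

namespace IsFlatSliceAt

theorem metric_two (h : IsFlatSliceAt G φ a x) (l m : Fin 4) :
    ContDiffAt ℝ 2 (fun y => G y l m) (φ x) := (h.metric l m).of_le (by norm_cast)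

theorem slice_two (h : IsFlatSliceAt G φ a x) : ContDiffAt ℝ 2 φ x :=
  h.slice.of_le (by norm_cast)

theorem normal_two (h : IsFlatSliceAt G φ a x) : ContDiffAt ℝ 2 a x :=
  h.normal.of_le (by norm_cast)

theorem differentiableAt_slice (h : IsFlatSliceAt G φ a x) : DifferentiableAt ℝ φ x :=
  h.slice_two.differentiableAt (by norm_num)

theorem differentiableAt_normal (h : IsFlatSliceAt G φ a x) : DifferentiableAt ℝ a x :=
  h.normal_two.differentiableAt (by norm_num)

theorem form_two (h : IsFlatSliceAt G φ a x) :
    ContDiffAt ℝ 2 (fun y => metricForm (G y)) (φ x) := contDiffAt_metricForm h.metric_two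

theorem differentiableAt_form (h : IsFlatSliceAt G φ a x) :
    DifferentiableAt ℝ (fun y => metricForm (G y)) (φ x) :=
  h.form_two.differentiableAt (by norm_num)

theorem form_symm (h : IsFlatSliceAt G φ a x) (u v : Eu 4) :
    metricForm (G (φ x)) u v = metricForm (G (φ x)) v u := metricForm_symm h.symm.self_of_nhds u v

theorem isFrame (h : IsFlatSliceAt G φ a x) : IsFrame (G (φ x)) (sliceFrame φ a x) := by
  intro b c
  have h1 := h.flat.self_of_nhds
  have h2 := h.unit.self_of_nhds
  have h3 := h.orth.self_of_nhds
  have h4 (i : Fin 3) : metricForm (G (φ x)) (fderiv ℝ φ x (e i)) (a x) = 0 := by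
    rw [h.form_symm]; exact h3 i
  induction b using Fin.lastCases with
  | last =>
    induction c using Fin.lastCases with
    | last => exact h2.trans (by simp [eta])
    | cast c =>
      rw [sliceFrame_castSucc]
      exact (h3 c).trans (by rw [if_neg (Fin.castSucc_ne_last c).symm])
  | cast b =>
    induction c using Fin.lastCases with
    | last =>
      rw [sliceFrame_castSucc]
      exact (h4 b).trans (by rw [if_neg (Fin.castSucc_ne_last b)])
    | cast c =>
      rw [sliceFrame_castSucc, sliceFrame_castSucc, h1, eta_castSucc]
      simp only [Fin.castSucc_inj]

theorem det_ne_zero (h : IsFlatSliceAt G φ a x) : (G (φ x)).det ≠ 0 := h.isFrame.det_ne_zero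

theorem eventually_det_ne_zero (h : IsFlatSliceAt G φ a x) :
    ∀ᶠ y in nhds (φ x), (G y).det ≠ 0 := by
  have h1 : ContinuousAt (fun y => (G y).det) (φ x) := by
    simp only [Matrix.det_apply]
    exact tendsto_finsetSum _ fun s _ => (tendsto_finsetProd _ fun i _ =>
      (h.metric _ _).continuousAt).const_smul _
  exact h1.eventually_ne h.det_ne_zero

theorem eventually_compat (h : IsFlatSliceAt G φ a x) :
    ∀ᶠ y in nhds (φ x), IsCompatAt (fun y => metricForm (G y)) (leviCivita G) y := by
  have h1 : ∀ᶠ y in nhds (φ x), ∀ l m, DifferentiableAt ℝ (fun y => G y l m) y := by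
    simp only [Filter.eventually_all]
    exact fun l m => ((h.metric_two l m).eventually (by norm_num)).mono
      fun y hy => hy.differentiableAt (by norm_num)
  filter_upwards [h1, h.symm.eventually_nhds, h.eventually_det_ne_zero] with y h1 h2 h3
  exact isCompatAt_leviCivita h1 h2 h3

theorem compat (h : IsFlatSliceAt G φ a x) :
    IsCompatAt (fun y => metricForm (G y)) (leviCivita G) (φ x) := h.eventually_compat.self_of_nhds

theorem differentiableAt_conn (h : IsFlatSliceAt G φ a x) :
    DifferentiableAt ℝ (leviCivita G) (φ x) :=
  differentiableAt_leviCivita h.metric_two h.det_ne_zero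

theorem conn_symm (h : IsFlatSliceAt G φ a x) (u v : Eu 4) :
    leviCivita G (φ x) u v = leviCivita G (φ x) v u := leviCivita_symm h.symm u v

theorem fderiv_flat (h : IsFlatSliceAt G φ a x) (v w : Eu 3) :
    fderiv ℝ (fun x => metricForm (G (φ x)) (fderiv ℝ φ x v) (fderiv ℝ φ x w)) x = 0 := by
  have h1 : (fun x => metricForm (G (φ x)) (fderiv ℝ φ x v) (fderiv ℝ φ x w))
      =ᶠ[nhds x] fun _ => ∑ i, ∑ j, v i * (w j * if i = j then 1 else 0) := by
    filter_upwards [h.flat] with x hx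
    rw [sum_apply_e (fderiv ℝ φ x) v, sum_apply_e (fderiv ℝ φ x) w]
    simp only [map_sum, sum_apply, map_smul, smul_apply, hx, smul_eq_mul, Finset.mul_sum]
    rw [Finset.sum_comm]
    exact Finset.sum_congr rfl fun i _ => Finset.sum_congr rfl fun j _ => by ring
  rw [h1.fderiv_eq, fderiv_fun_const]; rfl

theorem fderiv_orth (h : IsFlatSliceAt G φ a x) (v : Eu 3) :
    fderiv ℝ (fun x => metricForm (G (φ x)) (a x) (fderiv ℝ φ x v)) x = 0 := by
  have h1 : (fun x => metricForm (G (φ x)) (a x) (fderiv ℝ φ x v)) =ᶠ[nhds x] fun _ => 0 := by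
    filter_upwards [h.orth] with x hx
    rw [sum_apply_e (fderiv ℝ φ x) v]
    simp [map_sum, hx]
  rw [h1.fderiv_eq, fderiv_fun_const]; rfl

theorem fderiv_unit (h : IsFlatSliceAt G φ a x) :
    fderiv ℝ (fun x => metricForm (G (φ x)) (a x) (a x)) x = 0 := by
  have h1 : (fun x => metricForm (G (φ x)) (a x) (a x)) =ᶠ[nhds x] fun _ => -1 := h.unit
  rw [h1.fderiv_eq, fderiv_fun_const]; rfl

/-- Coordinate formula for the second fundamental form without Christoffel symbols. -/
theorem sliceExtrinsic_eq (h : IsFlatSliceAt G φ a x) (i j : Fin 3) :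
    sliceExtrinsic G φ a i j x = -(1 / 2) *
      (metricForm (G (φ x)) (fderiv ℝ a x (e i)) (fderiv ℝ φ x (e j))
        + metricForm (G (φ x)) (fderiv ℝ a x (e j)) (fderiv ℝ φ x (e i))
        + fderiv ℝ (fun y => metricForm (G y)) (φ x) (a x) (fderiv ℝ φ x (e i))
          (fderiv ℝ φ x (e j))) := by
  have h1 := two_mul_metric_cov_normal (G := fun y => metricForm (G y)) h.differentiableAt_form
    h.form_symm h.conn_symm h.compat h.slice_two h.differentiableAt_normal h.fderiv_orth (e i) (e j)
  rw [← h1, sliceExtrinsic]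
  ring

theorem sliceExtrinsic_symm (h : IsFlatSliceAt G φ a x) (i j : Fin 3) :
    sliceExtrinsic G φ a i j x = sliceExtrinsic G φ a j i x := by
  rw [h.sliceExtrinsic_eq, h.sliceExtrinsic_eq, h.compat, h.compat,
    h.form_symm (fderiv ℝ φ x (e i)),
    h.form_symm (fderiv ℝ φ x (e j))]
  ring

/-- Normal and tangential vectors are orthogonal because the three coordinate vectors together with
the normal form a complete frame. -/
theorem perp (h : IsFlatSliceAt G φ a x) (w w' : Eu 4)
    (hw : ∀ u, metricForm (G (φ x)) w (fderiv ℝ φ x u) = 0)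
    (hw' : metricForm (G (φ x)) w' (a x) = 0) : metricForm (G (φ x)) w' w = 0 := by
  rw [h.isFrame.metricForm_eq, Fin.sum_univ_castSucc]
  simp only [sliceFrame_castSucc, sliceFrame_last', hw', h.form_symm _ w, hw, mul_zero, zero_mul,
    Finset.sum_const_zero, add_zero]

/-- The convention `K_{ij} = - g(∇_i n, ∂_j)` reverses the order of the two derivatives compared
with `codazzi_of_flat`. -/
theorem codazzi (h : IsFlatSliceAt G φ a x) (i j k : Fin 3) :
    metricForm (G (φ x)) (fderiv ℝ φ x (e k))
      (curv (leviCivita G) (φ x) (fderiv ℝ φ x (e i)) (fderiv ℝ φ x (e j)) (a x))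
      = pd j (sliceExtrinsic G φ a i k) x - pd i (sliceExtrinsic G φ a j k) x := by
  have h1 := codazzi_of_flat (G := fun y => metricForm (G y)) h.differentiableAt_form
    h.form_symm h.conn_symm h.compat h.differentiableAt_conn h.slice_two h.normal_two h.fderiv_flat
    h.fderiv_unit h.perp (e i) (e j) (e k)
  have h2 (i j k : Fin 3) : fderiv ℝ (fun x => metricForm (G (φ x))
      (cov (leviCivita G) φ a x (e j)) (fderiv ℝ φ x (e k))) x (e i)
      = - pd i (sliceExtrinsic G φ a j k) x := by
    have : sliceExtrinsic G φ a j k = fun x => - metricForm (G (φ x))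
      (cov (leviCivita G) φ a x (e j)) (fderiv ℝ φ x (e k)) := rfl
    rw [this, pd, fderiv_fun_neg]
    simp
  rw [h1, h2, h2]
  ring

/-- Momentum constraint. -/
theorem momentum_constraint (h : IsFlatSliceAt G φ a x) (hric : ∀ m n, ricci G m n (φ x) = 0)
    (j : Fin 3) :
    ∑ i, (pd j (sliceExtrinsic G φ a i i) x - pd i (sliceExtrinsic G φ a j i) x) = 0 := by
  have h1 := sum_ricci h.metric_two h.det_ne_zero (a x) (fderiv ℝ φ x (e j))
  -- The operator is `u ↦ R(u, ∂_j) n`, whose trace is `Ric(n, ∂_j)`, zero by hypothesis.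
  have h2 := h.isFrame.trace_eq
    (((curvForm (leviCivita G) (φ x)).flip (fderiv ℝ φ x (e j))).flip (a x))
  simp only [ContinuousLinearMap.flip_apply, curvForm_apply] at h2
  rw [← h1] at h2
  simp only [hric, mul_zero, Finset.sum_const_zero] at h2
  rw [Fin.sum_univ_castSucc] at h2
  -- The normal direction contributes nothing to the trace, since the curvature is skew in its last
  -- pair `(n, n)`.
  have h3 : metricForm (G (φ x)) (a x)
      (curv (leviCivita G) (φ x) (a x) (fderiv ℝ φ x (e j)) (a x)) = 0 := by
    have := metric_curv_skew (G := fun y => metricForm (G y)) h.form_two h.differentiableAt_conn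
      h.eventually_compat (a x) (fderiv ℝ φ x (e j)) (a x) (a x)
    rw [h.form_symm _ (a x)] at this
    linarith
  simp only [sliceFrame_castSucc, h.codazzi] at h2
  rw [sliceFrame_last', h3, mul_zero, add_zero] at h2
  rw [h2]
  exact Finset.sum_congr rfl fun i _ => by rw [eta_castSucc, one_mul]

end IsFlatSliceAt

end Slice

/-! ### The magnetic part of the Weyl tensor on a flat slice -/

section Magnetic

theorem sum_four_comm {α β : Type*} [Fintype α] [Fintype β] (f : α → α → α → α → β → ℝ) :
    ∑ a, ∑ b, ∑ m, ∑ n, ∑ l, f a b m n l = ∑ l, ∑ a, ∑ b, ∑ m, ∑ n, f a b m n l := by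
  have h := Finset.sum_comm (s := (Finset.univ : Finset (α × α × α × α)))
    (t := (Finset.univ : Finset β)) (f := fun p l => f p.1 p.2.1 p.2.2.1 p.2.2.2 l)
  simpa only [Fintype.sum_prod_type] using h

variable {G : Eu 4 → Matrix (Fin 4) (Fin 4) ℝ} {y : Eu 4}

/-- The lowered indices of `ε` turn the frame vectors into coframe rows, and the density becomes
`det F`; the result has the shape that `IsFrame.sum_symb` evaluates. -/
theorem sum_epsMixed (F : Fin 4 → Eu 4) (hF : IsFrame (G y) F) (hs : ∀ l m, G y l m = G y m l)
    (c d l k : Fin 4) :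
    ∑ b, ∑ n, epsMixed G (Real.sign (frameMatrix F).det) l k n b y * F c n * F d b
      = ∑ r, ∑ s, (frameMatrix F).det * symb ![l, k, r, s]
        * coframeMatrix (G y) F c r * coframeMatrix (G y) F d s := by
  have h1 (c r : Fin 4) : coframeMatrix (G y) F c r = ∑ n, G y r n * F c n := by
    rw [coframeMatrix_apply, metricForm_symm hs, metricForm_e_left]
  have h2 (r s : Fin 4) : Real.sign (frameMatrix F).det * symb ![l, k, r, s] / √|(G y).det|
      = (frameMatrix F).det * symb ![l, k, r, s] := by
    rw [mul_div_right_comm, hF.sign_div_sqrt]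
  simp only [epsMixed, h2, h1, Finset.mul_sum, Finset.sum_mul]
  rw [Finset.sum_congr rfl fun b _ => Finset.sum_comm]
  rw [Finset.sum_comm]
  refine Finset.sum_congr rfl fun r _ => ?_
  rw [Finset.sum_congr rfl fun b _ => Finset.sum_comm]
  rw [Finset.sum_comm]
  refine Finset.sum_congr rfl fun s _ => ?_
  exact Finset.sum_congr rfl fun b _ => Finset.sum_congr rfl fun n _ => by ring

/-- With vanishing Ricci tensor Weyl is Riemann, so the dual contracts the two-form `R(·, ·)` with
`ε`, evaluated here on the frame instead of the coordinate basis. -/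
theorem sum_weylDual (hG : ∀ l m, ContDiffAt ℝ 2 (fun y => G y l m) y) (F : Fin 4 → Eu 4)
    (hF : IsFrame (G y) F) (hs : ∀ l m, G y l m = G y m l)
    (h0 : scalarCurv G y = 0) (hric : ∀ m n, ricci G m n y = 0) (i j c : Fin 4) :
    ∑ a, ∑ b, ∑ m, ∑ n, weylDual G (Real.sign (frameMatrix F).det) a m n b y
        * F c m * F c n * F i a * F j b
      = - (1 / 2) * ∑ p, ∑ q, eta p * eta q *
        metricForm (G y) (F i) (curv (leviCivita G) y (F p) (F q) (F c)) * symb ![p, q, c, j] := by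
  have hdet := hF.det_ne_zero
  have hΩ := hF.sum_symb (LinearMap.mk₂ ℝ
    (fun u v => metricForm (G y) (F i) (curv (leviCivita G) y u v (F c)))
    (by simp [← curvForm_apply]) (by simp [← curvForm_apply]) (by simp [← curvForm_apply])
    (by simp [← curvForm_apply])) c j
  simp only [LinearMap.mk₂_apply, ← sum_epsMixed F hF hs, ← sum_riemann hG hdet] at hΩ
  rw [neg_mul, ← mul_neg, ← hΩ]
  simp only [weylDual, weyl_eq_riemann h0 hric, Finset.mul_sum (a := (1 / 2 : ℝ)), Finset.sum_mul]
  rw [sum_four_comm]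
  refine Finset.sum_congr rfl fun l _ => ?_
  rw [sum_four_comm]
  refine Finset.sum_congr rfl fun k _ => ?_
  simp only [Finset.mul_sum]
  refine Finset.sum_congr rfl fun a _ => ?_
  rw [Finset.sum_comm]
  exact Finset.sum_congr rfl fun m _ => Finset.sum_congr rfl fun b _ =>
    Finset.sum_congr rfl fun n _ => by ring

/-- The magnetic part of the Weyl tensor on a flat slice, in terms of the curl of the second
fundamental form. -/
theorem IsFlatSliceAt.sum_weylDual {φ a : Eu 3 → Eu 4} {x : Eu 3} (h : IsFlatSliceAt G φ a x)
    (h0 : scalarCurv G (φ x) = 0) (hric : ∀ m n, ricci G m n (φ x) = 0) (i j : Fin 3) :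
    ∑ b, ∑ c, ∑ m, ∑ n, weylDual G (Real.sign (frameMatrix (sliceFrame φ a x)).det) b m n c (φ x)
        * a x m * a x n * fderiv ℝ φ x (e i) b * fderiv ℝ φ x (e j) c
      = (1 / 2) * ∑ p, ∑ q, symb ![p, q, j]
        * (pd q (sliceExtrinsic G φ a p i) x - pd p (sliceExtrinsic G φ a q i) x) := by
  have h1 := FlatSlice.sum_weylDual h.metric_two _ h.isFrame h.symm.self_of_nhds h0 hric
    i.castSucc j.castSucc 3
  simp only [sliceFrame_castSucc, sliceFrame_last] at h1
  rw [h1]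
  simp only [Fin.sum_univ_castSucc (n := 3), sliceFrame_castSucc, sliceFrame_last']
  have hl : Fin.last 3 = (3 : Fin 4) := rfl
  -- The normal index already occupies one slot of `ε`, so only tangential `p, q` survive, and for
  -- those Codazzi applies.
  simp only [hl, symb_four_left, symb_four_right, symb_four_spatial, eta_castSucc, h.codazzi]
  simp only [mul_zero, Finset.sum_const_zero, add_zero, one_mul, Finset.mul_sum]
  exact Finset.sum_congr rfl fun p _ => Finset.sum_congr rfl fun q _ => by ring

end Magnetic

/-! ### Charts of a manifold -/

section ChartFacts

variable {n : ℕ} {M : Type*} [TopologicalSpace M] [ChartedSpace (Eu n) M] [IsManifold (𝓡 n) ∞ M]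

/-- The derivative at `q` of the chart around `p`. -/
def chartDeriv (p q : M) : TangentSpace (𝓡 n) q →L[ℝ] Eu n :=
  mfderiv (𝓡 n) (𝓡 n) (extChartAt (𝓡 n) p) q

/-- The derivative at `y` of the inverse of the chart around `p`. -/
def chartSymmDeriv (p : M) (y : Eu n) :
    Eu n →L[ℝ] TangentSpace (𝓡 n) ((extChartAt (𝓡 n) p).symm y) :=
  mfderiv (𝓡 n) (𝓡 n) (extChartAt (𝓡 n) p).symm y

theorem chartDeriv_chartSymmDeriv (p : M) {y : Eu n} (hy : y ∈ (extChartAt (𝓡 n) p).target)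
    (v : Eu n) : chartDeriv p ((extChartAt (𝓡 n) p).symm y) (chartSymmDeriv p y v) = v := by
  have h := mfderiv_extChartAt_comp_mfderivWithin_extChartAt_symm hy
  rw [ModelWithCorners.range_eq_univ, mfderivWithin_univ] at h
  exact congrArg (fun L => L v) h

theorem chartSymmDeriv_chartDeriv (p : M) {y : Eu n} (hy : y ∈ (extChartAt (𝓡 n) p).target)
    (w : TangentSpace (𝓡 n) ((extChartAt (𝓡 n) p).symm y)) :
    chartSymmDeriv p y (chartDeriv p ((extChartAt (𝓡 n) p).symm y) w) = w := by
  have h := mfderivWithin_extChartAt_symm_comp_mfderiv_extChartAt hy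
  rw [ModelWithCorners.range_eq_univ, mfderivWithin_univ] at h
  exact congrArg (fun L => L w) h

omit [IsManifold (𝓡 n) ∞ M] in
theorem exists_symm_eq (p : M) {q : M} (hq : q ∈ (chartAt (Eu n) p).source) :
    ∃ y ∈ (extChartAt (𝓡 n) p).target, (extChartAt (𝓡 n) p).symm y = q := by
  have hq' : q ∈ (extChartAt (𝓡 n) p).source := by rwa [extChartAt_source]
  exact ⟨_, (extChartAt (𝓡 n) p).map_source hq', (extChartAt (𝓡 n) p).left_inv hq'⟩

theorem contMDiffAt_extChartAt_symm (p : M) {y : Eu n} (hy : y ∈ (extChartAt (𝓡 n) p).target) :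
    ContMDiffAt (𝓡 n) (𝓡 n) ∞ (extChartAt (𝓡 n) p).symm y :=
  (contMDiffOn_extChartAt_symm p).contMDiffAt ((isOpen_extChartAt_target p).mem_nhds hy)

/-- Translates smoothness of bundle sections, phrased with trivialisations, into smoothness of
components in a chart. -/
theorem trivializationAt_snd (p : M) {q : M} (hq : q ∈ (chartAt (Eu n) p).source)
    (w : TangentSpace (𝓡 n) q) :
    (trivializationAt (Eu n) (TangentSpace (𝓡 n)) p ⟨q, w⟩).2 = chartDeriv p q w := by
  have h := TangentBundle.continuousLinearMapAt_trivializationAt (I := 𝓡 n) hq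
  have h1 := Bundle.Trivialization.coe_linearMapAt_of_mem (R := ℝ)
    (trivializationAt (Eu n) (TangentSpace (𝓡 n)) p) (b := q) (by simpa using hq)
  exact (congrFun h1 w).symm.trans (congrArg (fun L => L w) h)

/-- The coordinate vector fields of a chart are smooth. -/
theorem contMDiffAt_coordField (p : M) {y : Eu n} (hy : y ∈ (extChartAt (𝓡 n) p).target)
    (v : Eu n) :
    ContMDiffAt (𝓡 n) (𝓡 n).tangent ∞ (fun y => (⟨(extChartAt (𝓡 n) p).symm y,
      chartSymmDeriv p y v⟩ : TangentBundle (𝓡 n) M)) y := by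
  have hsrc : ∀ y ∈ (extChartAt (𝓡 n) p).target,
      (extChartAt (𝓡 n) p).symm y ∈ (chartAt (Eu n) p).source := fun y hy => by
    rw [← extChartAt_source (𝓡 n)]; exact (extChartAt (𝓡 n) p).map_target hy
  rw [Bundle.Trivialization.contMDiffAt_iff (e := trivializationAt (Eu n) (TangentSpace (𝓡 n)) p)]
  · refine ⟨contMDiffAt_extChartAt_symm p hy, ?_⟩
    refine (contMDiffAt_const (c := v)).congr_of_eventuallyEq ?_
    filter_upwards [(isOpen_extChartAt_target p).mem_nhds hy] with z hz
    rw [trivializationAt_snd p (hsrc z hz), chartDeriv_chartSymmDeriv p hz]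
  · rw [Bundle.Trivialization.mem_source]
    simpa using hsrc y hy

end ChartFacts

/-! ### The metric components in a chart -/

section MetricInChart

variable {M : Type*} [TopologicalSpace M] [ChartedSpace (Eu 4) M] [IsManifold (𝓡 4) ∞ M]
  (g : LorentzianMetric M)

/-- Each component is the smooth metric section applied to two smooth coordinate fields. -/
theorem contDiffAt_inChart (p : M) {y : Eu 4} (hy : y ∈ (extChartAt (𝓡 4) p).target)
    (l m : Fin 4) : ContDiffAt ℝ ∞ (fun y => g.inChart p y l m) y := by
  have hg : ContMDiffAt (𝓡 4) ((𝓡 4).prod 𝓘(ℝ, Eu 4 →L[ℝ] Eu 4 →L[ℝ] ℝ)) ∞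
      (fun y => Bundle.TotalSpace.mk' (Eu 4 →L[ℝ] Eu 4 →L[ℝ] ℝ)
        (E := fun q : M => TangentSpace (𝓡 4) q →L[ℝ] TangentSpace (𝓡 4) q →L[ℝ] ℝ)
        ((extChartAt (𝓡 4) p).symm y) (g.val ((extChartAt (𝓡 4) p).symm y))) y :=
    (g.contMDiff _).comp y (contMDiffAt_extChartAt_symm p hy)
  have h := ContMDiffAt.clm_bundle_apply₂ (F₁ := Eu 4) (F₂ := Eu 4) (F₃ := ℝ)
    (E₁ := fun q : M => TangentSpace (𝓡 4) q) (E₂ := fun q : M => TangentSpace (𝓡 4) q)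
    (E₃ := Bundle.Trivial M ℝ)
    hg (contMDiffAt_coordField p hy (e l)) (contMDiffAt_coordField p hy (e m))
  rw [Bundle.contMDiffAt_totalSpace] at h
  exact h.2.contDiffAt

theorem inChart_symm (p : M) (y : Eu 4) (l m : Fin 4) : g.inChart p y l m = g.inChart p y m l :=
  g.symm _ _ _

theorem metricForm_inChart (p : M) (y v w : Eu 4) :
    metricForm (g.inChart p y) v w = g.val ((extChartAt (𝓡 4) p).symm y)
      (chartSymmDeriv p y v) (chartSymmDeriv p y w) := by
  conv_rhs => rw [← sum_smul_e v, ← sum_smul_e w]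
  rw [metricForm_apply]
  simp only [map_sum, map_smul, sum_apply, smul_apply, Finset.smul_sum]
  rw [Finset.sum_comm]
  refine Finset.sum_congr rfl fun l _ => Finset.sum_congr rfl fun m _ => ?_
  simp only [smul_eq_mul, LorentzianMetric.inChart, Matrix.of_apply]
  rw [mul_assoc, mul_comm, mul_assoc, mul_left_comm]
  rfl

/-- The components of the metric in a chart evaluate the metric. -/
theorem metricForm_inChart_chartDeriv (p : M) {q : M} (hq : q ∈ (chartAt (Eu 4) p).source)
    (v w : TangentSpace (𝓡 4) q) :
    metricForm (g.inChart p (extChartAt (𝓡 4) p q)) (chartDeriv p q v) (chartDeriv p q w)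
      = g.val q v w := by
  obtain ⟨y, hy, rfl⟩ := exists_symm_eq p hq
  rw [(extChartAt (𝓡 4) p).right_inv hy, metricForm_inChart, chartSymmDeriv_chartDeriv p hy,
    chartSymmDeriv_chartDeriv p hy]

end MetricInChart

/-! ### The hypersurface read in a chart -/

section SliceInChart

variable {M : Type*} [TopologicalSpace M] [ChartedSpace (Eu 4) M] [IsManifold (𝓡 4) ∞ M]
  {g : LorentzianMetric M} (Sg : FlatHypersurface g)

namespace FlatHypersurface

/-- The parametrisation of the slice in the chart around `p`. -/
def inChart (p : M) (x : Eu 3) : Eu 4 := extChartAt (𝓡 4) p (Sg.Φ x)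

/-- The unit normal of the slice in the chart around `p`. -/
def normalInChart (p : M) (x : Eu 3) : Eu 4 :=
  chartDeriv p (Sg.Φ x) (Sg.normal x)

variable {Sg} {p : M} {x : Eu 3}

theorem contMDiffAt_param (hx : x ∈ Sg.U) : ContMDiffAt (𝓡 3) (𝓡 4) ∞ Sg.Φ x :=
  Sg.smooth.contMDiffAt (Sg.isOpen.mem_nhds hx)

theorem eventually_mem (hx : x ∈ Sg.U) (hp : Sg.Φ x ∈ (chartAt (Eu 4) p).source) :
    ∀ᶠ x in nhds x, x ∈ Sg.U ∧ Sg.Φ x ∈ (chartAt (Eu 4) p).source :=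
  (Sg.isOpen.eventually_mem hx).and
    ((contMDiffAt_param hx).continuousAt.eventually_mem
      ((chartAt (Eu 4) p).open_source.mem_nhds hp))

theorem contDiffAt_inChart (hx : x ∈ Sg.U) (hp : Sg.Φ x ∈ (chartAt (Eu 4) p).source) :
    ContDiffAt ℝ ∞ (Sg.inChart p) x :=
  ((contMDiffAt_extChartAt' hp).comp x (contMDiffAt_param hx)).contDiffAt

theorem fderiv_inChart (hx : x ∈ Sg.U) (hp : Sg.Φ x ∈ (chartAt (Eu 4) p).source) (v : Eu 3) :
    fderiv ℝ (Sg.inChart p) x v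
      = chartDeriv p (Sg.Φ x) (mfderiv (𝓡 3) (𝓡 4) Sg.Φ x v) := by
  have h := mfderiv_comp x (mdifferentiableAt_extChartAt (I := 𝓡 4) hp)
    ((contMDiffAt_param hx).mdifferentiableAt (by norm_num))
  rw [← mfderiv_eq_fderiv]
  exact congrArg (fun L => L v) h

theorem contDiffAt_normalInChart (hx : x ∈ Sg.U) (hp : Sg.Φ x ∈ (chartAt (Eu 4) p).source) :
    ContDiffAt ℝ ∞ (Sg.normalInChart p) x := by
  have h := Sg.normal_smooth.contMDiffAt (Sg.isOpen.mem_nhds hx)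
  rw [Bundle.Trivialization.contMDiffAt_iff (e := trivializationAt (Eu 4) (TangentSpace (𝓡 4)) p)
    (he := by rw [Bundle.Trivialization.mem_source]; simpa using hp)] at h
  refine (h.2.congr_of_eventuallyEq ?_).contDiffAt
  filter_upwards [eventually_mem hx hp] with z hz
  exact (trivializationAt_snd p hz.2 _).symm

/-- The chart is any one whose domain contains `Φ x`, not only the one around `Φ x`, so that it can
stay fixed while the point varies. -/
theorem isFlatSliceAt (hx : x ∈ Sg.U) (hp : Sg.Φ x ∈ (chartAt (Eu 4) p).source) :
    IsFlatSliceAt (g.inChart p) (Sg.inChart p) (Sg.normalInChart p) x where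
  metric l m := FlatSlice.contDiffAt_inChart g p
    ((extChartAt (𝓡 4) p).map_source (by rwa [extChartAt_source])) l m
  slice := contDiffAt_inChart hx hp
  normal := contDiffAt_normalInChart hx hp
  symm := Filter.Eventually.of_forall fun y l m => inChart_symm g p y l m
  flat := by
    filter_upwards [eventually_mem hx hp] with z hz i j
    rw [fderiv_inChart hz.1 hz.2, fderiv_inChart hz.1 hz.2]
    exact (metricForm_inChart_chartDeriv g p hz.2 _ _).trans (Sg.flat z hz.1 i j)
  unit := by
    filter_upwards [eventually_mem hx hp] with z hz
    exact (metricForm_inChart_chartDeriv g p hz.2 _ _).trans (Sg.normal_unit z hz.1)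
  orth := by
    filter_upwards [eventually_mem hx hp] with z hz i
    rw [fderiv_inChart hz.1 hz.2]
    exact (metricForm_inChart_chartDeriv g p hz.2 _ _).trans (Sg.normal_orthogonal z hz.1 i)

end FlatHypersurface

end SliceInChart

/-! ### Transition maps between charts -/

section Transition

variable {n : ℕ} {M : Type*} [TopologicalSpace M] [ChartedSpace (Eu n) M] [IsManifold (𝓡 n) ∞ M]

/-- Transition map from the chart around `p'` to the chart around `p`. -/
def transition (p p' : M) (y : Eu n) : Eu n :=
  extChartAt (𝓡 n) p ((extChartAt (𝓡 n) p').symm y)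

variable {p p' : M}

theorem contDiffAt_transition {y : Eu n} (hy : y ∈ (extChartAt (𝓡 n) p').target)
    (hp : (extChartAt (𝓡 n) p').symm y ∈ (chartAt (Eu n) p).source) :
    ContDiffAt ℝ ∞ (transition p p') y :=
  ((contMDiffAt_extChartAt' hp).comp y (contMDiffAt_extChartAt_symm p' hy)).contDiffAt

theorem fderiv_transition {y : Eu n} (hy : y ∈ (extChartAt (𝓡 n) p').target)
    (hp : (extChartAt (𝓡 n) p').symm y ∈ (chartAt (Eu n) p).source) (v : Eu n) :
    fderiv ℝ (transition p p') y v
      = chartDeriv p ((extChartAt (𝓡 n) p').symm y) (chartSymmDeriv p' y v) := by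
  have h := mfderiv_comp y (mdifferentiableAt_extChartAt (I := 𝓡 n) hp)
    ((contMDiffAt_extChartAt_symm p' hy).mdifferentiableAt (by norm_num))
  rw [← mfderiv_eq_fderiv]
  exact congrArg (fun L => L v) h

theorem fderiv_transition_chartDeriv {q : M} (hp' : q ∈ (chartAt (Eu n) p').source)
    (hp : q ∈ (chartAt (Eu n) p).source) (w : TangentSpace (𝓡 n) q) :
    fderiv ℝ (transition p p') (extChartAt (𝓡 n) p' q) (chartDeriv p' q w)
      = chartDeriv p q w := by
  obtain ⟨y, hy, rfl⟩ := exists_symm_eq p' hp'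
  rw [(extChartAt (𝓡 n) p').right_inv hy, fderiv_transition hy hp, chartSymmDeriv_chartDeriv p' hy]

end Transition

/-! ### Extrinsic curvature and magnetic part of the hypersurface: chart independence, smoothness,
constraints -/

section SliceGeometry

variable {M : Type*} [TopologicalSpace M] [ChartedSpace (Eu 4) M] [IsManifold (𝓡 4) ∞ M]
  {g : LorentzianMetric M}

namespace FlatHypersurface

variable {Sg : FlatHypersurface g} {p p' : M} {x : Eu 3}

/-- Comparing the Koszul-type expressions avoids the transformation law of the Christoffel symbols:
`koszul_comp` is applied to the transition map. -/
theorem sliceExtrinsic_transition (hx : x ∈ Sg.U) (hp : Sg.Φ x ∈ (chartAt (Eu 4) p).source)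
    (hp' : Sg.Φ x ∈ (chartAt (Eu 4) p').source) (i j : Fin 3) :
    sliceExtrinsic (g.inChart p) (Sg.inChart p) (Sg.normalInChart p) i j x
      = sliceExtrinsic (g.inChart p') (Sg.inChart p') (Sg.normalInChart p') i j x := by
  have h := isFlatSliceAt hx hp
  have h' := isFlatSliceAt hx hp'
  have hsrc : Sg.Φ x ∈ (extChartAt (𝓡 4) p').source := by rwa [extChartAt_source]
  have hy : Sg.inChart p' x ∈ (extChartAt (𝓡 4) p').target := (extChartAt (𝓡 4) p').map_source hsrc
  have hsymm : (extChartAt (𝓡 4) p').symm (Sg.inChart p' x) = Sg.Φ x :=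
    (extChartAt (𝓡 4) p').left_inv hsrc
  have hτ : transition p p' (Sg.inChart p' x) = Sg.inChart p x := by
    rw [transition, hsymm]; rfl
  rw [h.sliceExtrinsic_eq, h'.sliceExtrinsic_eq]
  congr 1
  refine koszul_comp (G := fun y => metricForm (g.inChart p y))
    (G' := fun y => metricForm (g.inChart p' y)) (τ := transition p p') (ψ := Sg.inChart p')
    (c := Sg.normalInChart p') ?_ ?_ ?_ h'.differentiableAt_slice h'.differentiableAt_normal
    h'.differentiableAt_form ?_ ?_ ?_ (e i) (e j)
  · rw [hτ]; exact h.form_symm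
  · rw [hτ]; exact h.differentiableAt_form
  · exact (contDiffAt_transition hy (by rwa [hsymm])).of_le (by norm_cast)
  · have hc : ContinuousAt (extChartAt (𝓡 4) p').symm (Sg.inChart p' x) :=
      (contMDiffAt_extChartAt_symm p' hy).continuousAt
    filter_upwards [(isOpen_extChartAt_target p').mem_nhds hy,
      hc.eventually_mem ((chartAt (Eu 4) p).open_source.mem_nhds (by rwa [hsymm]))]
      with y hy hy' v w
    rw [metricForm_inChart, fderiv_transition hy hy', fderiv_transition hy hy']
    exact (metricForm_inChart_chartDeriv g p hy' _ _).symm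
  · filter_upwards [eventually_mem hx hp'] with z hz
    rw [Function.comp_apply, transition, inChart, inChart,
      (extChartAt (𝓡 4) p').left_inv (by rw [extChartAt_source]; exact hz.2)]
  · filter_upwards [eventually_mem hx hp', eventually_mem hx hp] with z hz' hz
    exact (fderiv_transition_chartDeriv hz'.2 hz.2 _).symm

theorem tangentComp_eq (hx : x ∈ Sg.U) (i : Fin 3) (m : Fin 4) :
    Sg.tangentComp x i m = fderiv ℝ (Sg.inChart (Sg.Φ x)) x (e i) m := by
  rw [fderiv_inChart hx (mem_chart_source _ _)]
  rfl

theorem normalComp_eq (y : Eu 3) (m : Fin 4) :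
    Sg.normalComp x y m = Sg.normalInChart (Sg.Φ x) y m := rfl

theorem extrinsic_eq_self (hx : x ∈ Sg.U) (i j : Fin 3) :
    Sg.extrinsic x i j = sliceExtrinsic (g.inChart (Sg.Φ x)) (Sg.inChart (Sg.Φ x))
      (Sg.normalInChart (Sg.Φ x)) i j x := by
  have h := isFlatSliceAt hx (mem_chart_source (Eu 4) (Sg.Φ x))
  have hcov (l : Fin 4) : Sg.covDerivNormal x i l
      = cov (leviCivita (g.inChart (Sg.Φ x))) (Sg.inChart (Sg.Φ x)) (Sg.normalInChart (Sg.Φ x)) x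
        (e i) l := by
    rw [cov, PiLp.add_apply, leviCivita, connForm_apply, covDerivNormal]
    congr 1
    · have h1 := ((EuclideanSpace.proj l : Eu 4 →L[ℝ] ℝ).hasFDerivAt.comp x
        h.differentiableAt_normal.hasFDerivAt).fderiv
      exact congrArg (fun L => L (e i)) h1
    · simp only [tangentComp_eq hx, normalComp_eq]
      rfl
  rw [extrinsic, sliceExtrinsic, metricForm_apply]
  simp only [hcov, tangentComp_eq hx]
  rfl

/-- The extrinsic curvature can be computed in any chart. -/
theorem extrinsic_eq (hx : x ∈ Sg.U) (hp : Sg.Φ x ∈ (chartAt (Eu 4) p).source) (i j : Fin 3) :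
    Sg.extrinsic x i j
      = sliceExtrinsic (g.inChart p) (Sg.inChart p) (Sg.normalInChart p) i j x := by
  rw [extrinsic_eq_self hx, sliceExtrinsic_transition hx (mem_chart_source _ _) hp]

theorem extrinsic_symm (hx : x ∈ Sg.U) (i j : Fin 3) : Sg.extrinsic x i j = Sg.extrinsic x j i := by
  rw [extrinsic_eq_self hx, extrinsic_eq_self hx,
    (isFlatSliceAt hx (mem_chart_source _ _)).sliceExtrinsic_symm]

/-- Freezes the chart near `x`, so that partial derivatives of the extrinsic curvature can be
computed in a single chart. -/
theorem extrinsic_eventuallyEq (hx : x ∈ Sg.U) (hp : Sg.Φ x ∈ (chartAt (Eu 4) p).source)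
    (i j : Fin 3) : (fun x => Sg.extrinsic x i j)
      =ᶠ[nhds x] sliceExtrinsic (g.inChart p) (Sg.inChart p) (Sg.normalInChart p) i j := by
  filter_upwards [eventually_mem hx hp] with z hz using extrinsic_eq hz.1 hz.2 i j

theorem contDiffAt_extrinsic (hx : x ∈ Sg.U) (i j : Fin 3) :
    ContDiffAt ℝ ∞ (fun x => Sg.extrinsic x i j) x := by
  have hp := mem_chart_source (Eu 4) (Sg.Φ x)
  have h := isFlatSliceAt hx hp
  refine ContDiffAt.congr_of_eventuallyEq ?_ (extrinsic_eventuallyEq hx hp i j)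
  set p := Sg.Φ x
  -- The Koszul-type expression is visibly smooth: it contains no inverse metric, only the metric,
  -- the slice, the normal and their first derivatives.
  refine ContDiffAt.congr_of_eventuallyEq (f := fun x => -(1 / 2) *
      (metricForm (g.inChart p (Sg.inChart p x)) (fderiv ℝ (Sg.normalInChart p) x (e i))
          (fderiv ℝ (Sg.inChart p) x (e j))
        + metricForm (g.inChart p (Sg.inChart p x)) (fderiv ℝ (Sg.normalInChart p) x (e j))
          (fderiv ℝ (Sg.inChart p) x (e i))
        + fderiv ℝ (fun y => metricForm (g.inChart p y)) (Sg.inChart p x) (Sg.normalInChart p x)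
          (fderiv ℝ (Sg.inChart p) x (e i)) (fderiv ℝ (Sg.inChart p) x (e j)))) ?_ ?_
  · have hG : ContDiffAt ℝ ∞ (fun y => metricForm (g.inChart p y)) (Sg.inChart p x) :=
      contDiffAt_metricForm h.metric
    have h1 : ContDiffAt ℝ ∞ (fun x => metricForm (g.inChart p (Sg.inChart p x))) x :=
      hG.comp x h.slice
    have h2 : ContDiffAt ℝ ∞
        (fun x => fderiv ℝ (fun y => metricForm (g.inChart p y)) (Sg.inChart p x)) x :=
      (hG.fderiv_right (m := ∞) (by norm_num)).comp x h.slice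
    have h3 (i : Fin 3) : ContDiffAt ℝ ∞ (fun x => fderiv ℝ (Sg.inChart p) x (e i)) x :=
      (h.slice.fderiv_right (m := ∞) (by norm_num)).clm_apply contDiffAt_const
    have h4 (i : Fin 3) : ContDiffAt ℝ ∞ (fun x => fderiv ℝ (Sg.normalInChart p) x (e i)) x :=
      (h.normal.fderiv_right (m := ∞) (by norm_num)).clm_apply contDiffAt_const
    exact contDiffAt_const.mul ((((h1.clm_apply (h4 i)).clm_apply (h3 j)).add
      ((h1.clm_apply (h4 j)).clm_apply (h3 i))).add
      (((h2.clm_apply h.normal).clm_apply (h3 i)).clm_apply (h3 j)))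
  · filter_upwards [eventually_mem hx hp] with z hz
    exact (isFlatSliceAt hz.1 hz.2).sliceExtrinsic_eq i j

theorem ricci_eq_zero (hvac : g.IsVacuum) (hx : x ∈ Sg.U) :
    scalarCurv (g.inChart (Sg.Φ x)) (Sg.inChart (Sg.Φ x) x) = 0 ∧
      ∀ m n, ricci (g.inChart (Sg.Φ x)) m n (Sg.inChart (Sg.Φ x) x) = 0 :=
  ricci_eq_zero_of_vacuum (inChart_symm g _ _)
    (isFlatSliceAt hx (mem_chart_source (Eu 4) (Sg.Φ x))).det_ne_zero (hvac (Sg.Φ x))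

/-- Momentum constraint of the vacuum equations. -/
theorem sum_pd_extrinsic (hvac : g.IsVacuum) (hx : x ∈ Sg.U) (j : Fin 3) :
    ∑ i, (pd j (fun x => Sg.extrinsic x i i) x - pd i (fun x => Sg.extrinsic x j i) x) = 0 := by
  have hp := mem_chart_source (Eu 4) (Sg.Φ x)
  have h := (isFlatSliceAt hx hp).momentum_constraint (ricci_eq_zero hvac hx).2 j
  rw [← h]
  simp only [pd, (extrinsic_eventuallyEq hx hp _ _).fderiv_eq]

/-- The magnetic part of the Weyl tensor as a curl of the extrinsic curvature. -/
theorem magnetic_eq (hvac : g.IsVacuum) (hx : x ∈ Sg.U) (i j : Fin 3) :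
    Sg.magnetic x i j = (1 / 2) * ∑ p, ∑ q, symb ![p, q, j]
      * (pd q (fun x => Sg.extrinsic x p i) x - pd p (fun x => Sg.extrinsic x q i) x) := by
  have hp := mem_chart_source (Eu 4) (Sg.Φ x)
  have h := (isFlatSliceAt hx hp).sum_weylDual (ricci_eq_zero hvac hx).1
    (ricci_eq_zero hvac hx).2 i j
  simp only [pd, (extrinsic_eventuallyEq hx hp _ _).fderiv_eq]
  refine Eq.trans ?_ h
  have hsign : Sg.chartSign x = Real.sign (frameMatrix (sliceFrame (Sg.inChart (Sg.Φ x))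
      (Sg.normalInChart (Sg.Φ x)) x)).det := by
    rw [chartSign]
    congr 2
    ext m a
    fin_cases a <;> simp [frameMatrix, sliceFrame, tangentComp_eq hx, normalComp_eq]
  rw [magnetic, hsign]
  simp only [tangentComp_eq hx, normalComp_eq]
  rfl

end FlatHypersurface

end SliceGeometry

/-! ### Curls and the conformal Killing fields -/

section Curl

/-- Curl of a vector field on `ℝ³`. -/
def curl (V : Eu 3 → Fin 3 → ℝ) (x : Eu 3) (i : Fin 3) : ℝ :=
  ∑ m, ∑ l, symb ![i, m, l] * pd m (fun y => V y l) x

/-- A Vandermonde product, equal to `2` on `(0, 1, 2)` and hence divided by `2`. It turns the later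
finite index checks into arithmetic. -/
theorem symb_three (i j k : Fin 3) :
    symb ![i, j, k] = ((j : ℝ) - i) * ((k : ℝ) - i) * ((k : ℝ) - j) / 2 := by
  have h : ∀ i j k : Fin 3, 2 * (Matrix.of fun a b => if ![i, j, k] a = b then (1 : ℤ) else 0).det
      = ((j : ℕ) - (i : ℕ) : ℤ) * ((k : ℕ) - (i : ℕ) : ℤ) * ((k : ℕ) - (j : ℕ) : ℤ) := by
    decide +kernel
  have h1 := congrArg (Int.cast : ℤ → ℝ) (h i j k)
  simp only [Int.cast_mul, Int.cast_sub, Int.cast_natCast, Int.cast_ofNat] at h1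
  rw [symb_eq_intCast, eq_div_iff two_ne_zero, mul_comm, h1]

/-- The middle term is the pure trace that makes the field conformal Killing; the other two form the
antisymmetric, rotational part. -/
theorem pd_properConformal (k m j : Fin 3) (x : Eu 3) :
    pd m (fun y => properConformal k y j) x
      = (if k = m then 1 else 0) * x j + x k * (if j = m then 1 else 0)
        - x m * (if j = k then 1 else 0) := by
  have hp (i : Fin 3) : HasFDerivAt (fun y : Eu 3 => y i)
      (EuclideanSpace.proj i : Eu 3 →L[ℝ] ℝ) x :=
    (EuclideanSpace.proj i : Eu 3 →L[ℝ] ℝ).hasFDerivAt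
  have hn : HasFDerivAt (fun y : Eu 3 => ‖y‖ ^ 2) (2 • innerSL ℝ x) x :=
    (hasStrictFDerivAt_norm_sq x).hasFDerivAt
  have h := ((hp k).fun_mul (hp j)).fun_sub
    ((hn.const_mul (1 / 2)).mul_const (if j = k then (1 : ℝ) else 0))
  have hi : innerSL ℝ x (e m) = x m := by
    simp [e, EuclideanSpace.inner_single_right]
  have h1 : (fun y => properConformal k y j)
      = fun y : Eu 3 => y k * y j - 1 / 2 * ‖y‖ ^ 2 * if j = k then (1 : ℝ) else 0 := rfl
  rw [pd, h1, h.fderiv]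
  simp only [sub_apply, add_apply, smul_apply, smul_eq_mul, hi, PiLp.proj_apply, e_apply,
    nsmul_eq_mul]
  push_cast
  ring

theorem contDiff_properConformal (k j : Fin 3) : ContDiff ℝ ∞ (fun y => properConformal k y j) := by
  unfold properConformal scaling translation
  have hp (i : Fin 3) : ContDiff ℝ ∞ (fun y : Eu 3 => y i) :=
    (EuclideanSpace.proj i : Eu 3 →L[ℝ] ℝ).contDiff
  exact ((hp k).mul (hp j)).sub ((contDiff_const.mul (contDiff_norm_sq ℝ)).mul contDiff_const)

end Curl

/-! ### The pointwise identity between the two flux densities -/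

section FluxDensity

variable {M : Type*} [TopologicalSpace M] [ChartedSpace (Eu 4) M] [IsManifold (𝓡 4) ∞ M]
  {g : LorentzianMetric M}

namespace FlatHypersurface

variable {Sg : FlatHypersurface g} {x : Eu 3}

theorem pd_extrinsic_symm (hx : x ∈ Sg.U) (m i j : Fin 3) :
    pd m (fun x => Sg.extrinsic x i j) x = pd m (fun x => Sg.extrinsic x j i) x := by
  have h : (fun x => Sg.extrinsic x i j) =ᶠ[nhds x] fun x => Sg.extrinsic x j i :=
    (Sg.isOpen.eventually_mem hx).mono fun y hy => extrinsic_symm hy i j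
  rw [pd, h.fderiv_eq, pd]

/-- The magnetic part is minus the curl of the extrinsic curvature. -/
theorem magnetic_eq_neg_curl (hvac : g.IsVacuum) (hx : x ∈ Sg.U) (i j : Fin 3) :
    Sg.magnetic x i j = - curl (fun x l => Sg.extrinsic x l j) x i := by
  have h0 := sum_pd_extrinsic hvac hx 0
  have h1 := sum_pd_extrinsic hvac hx 1
  have h2 := sum_pd_extrinsic hvac hx 2
  -- `magnetic_eq` gives the curl with `i` and `j` exchanged. The two versions differ by the
  -- antisymmetric part of `curl K`, which vanishes by the momentum constraints `h0`, `h1`, `h2`.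
  rw [magnetic_eq hvac hx, curl]
  have s10 (m : Fin 3) := pd_extrinsic_symm hx m 1 0
  have s20 (m : Fin 3) := pd_extrinsic_symm hx m 2 0
  have s21 (m : Fin 3) := pd_extrinsic_symm hx m 2 1
  simp only [Fin.sum_univ_three, symb_three] at h0 h1 h2 ⊢
  fin_cases i <;> fin_cases j <;>
    simp [s10, s20, s21] at h0 h1 h2 ⊢ <;> linarith

/-- Pointwise form of the relation between the magnetic part and the momentum. -/
theorem sum_magnetic_mul_properConformal (hvac : g.IsVacuum) (hx : x ∈ Sg.U) (k i : Fin 3) :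
    ∑ j, Sg.magnetic x i j * properConformal k x j
      = ∑ j, Sg.admMomentum x i j * rotation k x j
        - curl (fun x l => ∑ j, Sg.extrinsic x l j * properConformal k x j) x i := by
  have hpd (m l : Fin 3) : pd m (fun x => ∑ j, Sg.extrinsic x l j * properConformal k x j) x
      = ∑ j, (pd m (fun x => Sg.extrinsic x l j) x * properConformal k x j
        + Sg.extrinsic x l j * pd m (fun y => properConformal k y j) x) := by
    have hK (j : Fin 3) :=
      ((contDiffAt_extrinsic hx l j).differentiableAt (by norm_num)).hasFDerivAt
    have hX (j : Fin 3) :=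
      ((contDiff_properConformal k j).differentiable (by norm_num) x).hasFDerivAt
    have h := HasFDerivAt.fun_sum (u := Finset.univ) fun j _ => (hK j).fun_mul (hX j)
    rw [pd, h.fderiv]
    simp only [sum_apply, add_apply, smul_apply, smul_eq_mul, pd]
    exact Finset.sum_congr rfl fun j _ => by ring
  have s10 := extrinsic_symm hx 1 0
  have s20 := extrinsic_symm hx 2 0
  have s21 := extrinsic_symm hx 2 1
  -- The derivatives of `K` cancel against the magnetic part. What remains is an algebraic identity
  -- for the symmetric matrix `K`, an instance of `K` acting on `ε` as a derivation by its trace.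
  simp only [magnetic_eq_neg_curl hvac hx, curl, hpd, pd_properConformal, admMomentum, rotation]
  simp only [Fin.sum_univ_three, symb_three]
  fin_cases k <;> fin_cases i <;> simp [s10, s20, s21] <;> ring

end FlatHypersurface

end FluxDensity

/-! ### Stokes' theorem in the plane -/

section Stokes

variable {V : Type*} [NormedAddCommGroup V] [NormedSpace ℝ V]

/-- `(da ∧ db)(v, w)` at `u`. -/
def wedge (a b : V → ℝ) (u v w : V) : ℝ :=
  fderiv ℝ a u v * fderiv ℝ b u w - fderiv ℝ a u w * fderiv ℝ b u v

/-- This is `d(a db) = da ∧ db`: the second derivatives of `b` cancel by symmetry. -/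
theorem fderiv_mul_fderiv_sub {a b : V → ℝ} {u : V} (ha : ContDiffAt ℝ 2 a u)
    (hb : ContDiffAt ℝ 2 b u) (v w : V) :
    fderiv ℝ (fun u => a u * fderiv ℝ b u w) u v - fderiv ℝ (fun u => a u * fderiv ℝ b u v) u w
      = wedge a b u v w := by
  have h1 := (ha.differentiableAt (by norm_num)).hasFDerivAt
  have h (w : V) := h1.fun_mul (differentiableAt_fderiv_apply hb w).hasFDerivAt
  rw [(h v).fderiv, (h w).fderiv, wedge]
  simp only [add_apply, smul_apply, smul_eq_mul, fderiv_fderiv_apply hb]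
  rw [fderiv_fderiv_symm hb v w]
  ring

theorem sign_mul_self_eq_abs (x : ℝ) : Real.sign x * x = |x| := by
  rcases lt_trichotomy x 0 with h | rfl | h
  · rw [Real.sign_of_neg h, abs_of_neg h, neg_one_mul]
  · simp
  · rw [Real.sign_of_pos h, abs_of_pos h, one_mul]

omit [NormedSpace ℝ V] in
theorem eventually_sign_eq {s : V → ℝ} {u : V} (hs : ContinuousAt s u) (h : s u ≠ 0) :
    ∀ᶠ z in nhds u, Real.sign (s z) = Real.sign (s u) := by
  rcases lt_or_gt_of_ne h with h | h
  · filter_upwards [hs.eventually_lt_const h] with z hz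
    rw [Real.sign_of_neg hz, Real.sign_of_neg h]
  · filter_upwards [hs.eventually_const_lt h] with z hz
    rw [Real.sign_of_pos hz, Real.sign_of_pos h]

variable [MeasurableSpace V] [BorelSpace V] [FiniteDimensional ℝ V] {μ : MeasureTheory.Measure V}
  [μ.IsAddHaarMeasure] {T K : Set V}

open MeasureTheory

omit [NormedSpace ℝ V] [FiniteDimensional ℝ V] in
theorem integrableOn_of_continuousOn {g : V → ℝ} (hT : IsOpen T) (hK : IsCompact K) (hKT : K ⊆ T)
    (hg : ContinuousOn g T) (h0 : ∀ u ∈ T \ K, g u = 0) : IntegrableOn g T μ :=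
  ((hg.mono hKT).integrableOn_compact hK).of_forall_sdiff_eq_zero hT.measurableSet h0

/-- Extension by zero makes the function `C¹` with compact support on the whole space; integrating
by parts against the constant `1` then gives zero. -/
theorem setIntegral_fderiv_eq_zero {g : V → ℝ} (hT : IsOpen T) (hK : IsCompact K) (hKT : K ⊆ T)
    (hg : ∀ u ∈ T, ContDiffAt ℝ 1 g u) (h0 : ∀ u ∈ T \ K, g u = 0) (v : V) :
    IntegrableOn (fun u => fderiv ℝ g u v) T μ ∧ ∫ u in T, fderiv ℝ g u v ∂μ = 0 := by
  classical
  set G : V → ℝ := T.indicator g with hG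
  have hGg : ∀ u ∈ T, G =ᶠ[nhds u] g := fun u hu => by
    filter_upwards [hT.mem_nhds hu] with z hz
    exact Set.indicator_of_mem hz g
  have hG0 : ∀ u ∉ K, G u = 0 := fun u hu => by
    by_cases h : u ∈ T
    · rw [hG, Set.indicator_of_mem h, h0 u ⟨h, hu⟩]
    · exact Set.indicator_of_notMem h g
  have hGe : ∀ u ∉ K, G =ᶠ[nhds u] fun _ => 0 := fun u hu => by
    filter_upwards [hK.isClosed.isOpen_compl.mem_nhds hu] with z hz using hG0 z hz
  have hGC : ContDiff ℝ 1 G := contDiff_iff_contDiffAt.2 fun u => by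
    by_cases h : u ∈ K
    · exact (hg u (hKT h)).congr_of_eventuallyEq (hGg u (hKT h))
    · exact contDiffAt_const.congr_of_eventuallyEq (hGe u h)
  have hc : HasCompactSupport G := HasCompactSupport.intro hK hG0
  have hd : Integrable (fun u => fderiv ℝ G u v) μ :=
    ((hGC.continuous_fderiv (by norm_num)).clm_apply
      continuous_const).integrable_of_hasCompactSupport (hc.fderiv_apply ℝ v)
  have hI : ∫ u, fderiv ℝ G u v ∂μ = 0 := by
    have h := integral_mul_fderiv_eq_neg_fderiv_mul_of_integrable (μ := μ)
      (f := fun _ : V => (1 : ℝ))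
      (g := G) (v := v) (by simp) (by simpa using hd)
      (by simpa using hGC.continuous.integrable_of_hasCompactSupport hc)
      (fun _ _ => differentiableAt_const _) (fun u _ => hGC.differentiable (by norm_num) u)
    simpa using h
  have he : ∀ u ∈ T, fderiv ℝ G u v = fderiv ℝ g u v := fun u hu => by
    rw [(hGg u hu).fderiv_eq]
  refine ⟨hd.integrableOn.congr_fun he hT.measurableSet, ?_⟩
  rw [← setIntegral_congr_fun hT.measurableSet he, setIntegral_eq_integral_of_forall_compl_eq_zero,
    hI]
  intro u hu
  rw [(hGe u fun h => hu (hKT h)).fderiv_eq]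
  simp

/-- The integral of an exact compactly supported two-form over an oriented open set. -/
theorem setIntegral_sign_mul_wedge {a b s : V → ℝ} (hT : IsOpen T) (hK : IsCompact K) (hKT : K ⊆ T)
    (ha : ∀ u ∈ T, ContDiffAt ℝ 2 a u) (hb : ∀ u ∈ T, ContDiffAt ℝ 2 b u)
    (hs : ContinuousOn s T) (hs0 : ∀ u ∈ T, s u ≠ 0) (h0 : ∀ u ∈ T \ K, a u = 0) (v w : V) :
    ∫ u in T, Real.sign (s u) * wedge a b u v w ∂μ = 0 := by
  -- The orientation sign may differ between components of `T`, but it is locally constant, so it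
  -- can be absorbed into the function being differentiated.
  set g : V → V → ℝ := fun w u => Real.sign (s u) * (a u * fderiv ℝ b u w) with hg
  have hge (w : V) : ∀ u ∈ T, g w =ᶠ[nhds u]
      fun z => Real.sign (s u) * (a z * fderiv ℝ b z w) := fun u hu => by
    filter_upwards [eventually_sign_eq (hs.continuousAt (hT.mem_nhds hu)) (hs0 u hu)] with z hz
    simp only [hg, hz]
  have hgd (w : V) : ∀ u ∈ T, ContDiffAt ℝ 1 (fun u => a u * fderiv ℝ b u w) u := fun u hu =>
    ((ha u hu).of_le (by norm_num)).mul
      (((hb u hu).fderiv_right (m := 1) (by norm_num)).clm_apply contDiffAt_const)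
  have h1 (w v : V) := setIntegral_fderiv_eq_zero (μ := μ) (g := g w) hT hK hKT
    (fun u hu => (contDiffAt_const.mul (hgd w u hu)).congr_of_eventuallyEq (hge w u hu))
    (fun u hu => by simp [hg, h0 u hu]) v
  have h2 := integral_sub (h1 w v).1 (h1 v w).1
  rw [(h1 w v).2, (h1 v w).2, sub_zero] at h2
  rw [← h2]
  refine setIntegral_congr_fun hT.measurableSet fun u hu => ?_
  have h3 (w v : V) : fderiv ℝ (g w) u v
      = Real.sign (s u) * fderiv ℝ (fun u => a u * fderiv ℝ b u w) u v := by
    rw [(hge w u hu).fderiv_eq, fderiv_const_mul ((hgd w u hu).differentiableAt (by norm_num))]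
    rfl
  simp only [h3]
  rw [← fderiv_mul_fderiv_sub (ha u hu) (hb u hu), mul_sub]

end Stokes

/-! ### The area form of an immersed surface -/

section Cross

/-- Cross product in `ℝ³`. -/
def cross (v w : Eu 3) (i : Fin 3) : ℝ := ∑ m, ∑ l, symb ![i, m, l] * (v m * w l)

theorem cross_eq_sub (v w : Eu 3) :
    cross v w = ![v 1 * w 2 - v 2 * w 1, v 2 * w 0 - v 0 * w 2, v 0 * w 1 - v 1 * w 0] := by
  funext i
  simp only [cross, Fin.sum_univ_three, symb_three]
  fin_cases i <;> simp <;> ring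

/-- The cross product of two tangent vectors is parallel to the unit normal, so projecting it onto
`ν` loses nothing. -/
theorem cross_mul_sum {ν v w : Eu 3} (hν : ‖ν‖ = 1) (hv : inner ℝ ν v = 0)
    (hw : inner ℝ ν w = 0) (i : Fin 3) : (∑ j, ν j * cross v w j) * ν i = cross v w i := by
  have h : ‖ν‖ ^ 2 = 1 := by rw [hν, one_pow]
  rw [EuclideanSpace.real_norm_sq_eq] at h
  simp only [PiLp.inner_apply, RCLike.inner_apply, conj_trivial, Fin.sum_univ_three] at h hv hw
  simp only [cross_eq_sub, Fin.sum_univ_three]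
  fin_cases i <;> simp
  -- The coefficients are the components of `v × w`, `-(ν × w)` and `ν × v`, from expanding `ν × (ν
  -- × (v × w))`.
  · linear_combination (v 1 * w 2 - v 2 * w 1) * h + (-ν 1 * w 2 + ν 2 * w 1) * hv
      + (ν 1 * v 2 - ν 2 * v 1) * hw
  · linear_combination (v 2 * w 0 - v 0 * w 2) * h + (-ν 2 * w 0 + ν 0 * w 2) * hv
      + (ν 2 * v 0 - ν 0 * v 2) * hw
  · linear_combination (v 0 * w 1 - v 1 * w 0) * h + (-ν 0 * w 1 + ν 1 * w 0) * hv
      + (ν 0 * v 1 - ν 1 * v 0) * hw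

theorem sum_cross_sq (v w : Eu 3) :
    ∑ i, cross v w i ^ 2 = inner ℝ v v * inner ℝ w w - inner ℝ v w * inner ℝ w v := by
  simp only [PiLp.inner_apply, RCLike.inner_apply, conj_trivial, Fin.sum_univ_three, cross_eq_sub]
  simp
  ring

theorem sq_sum_mul_cross {ν v w : Eu 3} (hν : ‖ν‖ = 1) (hv : inner ℝ ν v = 0)
    (hw : inner ℝ ν w = 0) : (∑ j, ν j * cross v w j) ^ 2
      = inner ℝ v v * inner ℝ w w - inner ℝ v w * inner ℝ w v := by
  rw [← sum_cross_sq, sq, Finset.mul_sum]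
  refine Finset.sum_congr rfl fun i _ => ?_
  rw [sq, ← mul_assoc, cross_mul_sum hν hv hw]

/-- Its square is the Gram determinant of the images of the basis; if that vanished, equality in
Cauchy–Schwarz would make them dependent, against injectivity. -/
theorem sum_mul_cross_ne_zero {ν : Eu 3} (hν : ‖ν‖ = 1) {L : Eu 2 →L[ℝ] Eu 3}
    (hL : ∀ v, inner ℝ ν (L v) = 0) (hi : Function.Injective L) :
    ∑ j, ν j * cross (L (e 0)) (L (e 1)) j ≠ 0 := by
  intro h
  have h1 := sq_sum_mul_cross hν (hL (e 0)) (hL (e 1))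
  rw [h, real_inner_comm (L (e 1)) (L (e 0))] at h1
  set a := inner ℝ (L (e 0)) (L (e 0)) with ha
  set b := inner ℝ (L (e 1)) (L (e 0)) with hb
  -- The squared norm of this vector is `a` times the Gram determinant.
  have h2 : L (a • e 1 - b • e 0) = 0 := by
    rw [← inner_self_eq_zero (𝕜 := ℝ), map_sub, map_smul, map_smul]
    simp only [inner_sub_left, inner_sub_right, inner_smul_left, inner_smul_right, conj_trivial,
      real_inner_comm (L (e 1)) (L (e 0)), ← ha, ← hb]
    linear_combination -a * h1
  have h3 : a • (e 1 : Eu 2) - b • e 0 = 0 := hi (h2.trans (map_zero L).symm)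
  have h4 : a = 0 := by simpa [e_apply] using congrArg (fun v : Eu 2 => v 1) h3
  have h5 : (e 0 : Eu 2) = 0 := hi (by rw [map_zero]; exact inner_self_eq_zero.1 h4)
  simpa [e_apply] using congrArg (fun v : Eu 2 => v 0) h5

theorem det_eq_fin_two (N : Eu 2 →L[ℝ] Eu 2) :
    N.det = N (e 0) 0 * N (e 1) 1 - N (e 0) 1 * N (e 1) 0 := by
  rw [ContinuousLinearMap.det, ← LinearMap.det_toMatrix (EuclideanSpace.basisFun (Fin 2) ℝ).toBasis,
    Matrix.det_fin_two]
  simp [LinearMap.toMatrix_apply, e]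
  ring

theorem cross_comp (L : Eu 2 →L[ℝ] Eu 3) (N : Eu 2 →L[ℝ] Eu 2) (i : Fin 3) :
    cross (L (N (e 0))) (L (N (e 1))) i = N.det * cross (L (e 0)) (L (e 1)) i := by
  rw [det_eq_fin_two, sum_apply_e L (N (e 0)), sum_apply_e L (N (e 1))]
  simp only [cross_eq_sub, Fin.sum_univ_two]
  fin_cases i <;> simp <;> ring

/-- Together with `cross_comp`: two-forms on the plane scale by the determinant, so the ratio of two
of them does not depend on the chart. -/
theorem wedge_comp (A B : Eu 2 →L[ℝ] ℝ) (N : Eu 2 →L[ℝ] Eu 2) :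
    A (N (e 0)) * B (N (e 1)) - A (N (e 1)) * B (N (e 0))
      = N.det * (A (e 0) * B (e 1) - A (e 1) * B (e 0)) := by
  rw [det_eq_fin_two, sum_apply_e A (N (e 0)), sum_apply_e A (N (e 1)), sum_apply_e B (N (e 0)),
    sum_apply_e B (N (e 1))]
  simp only [Fin.sum_univ_two, smul_eq_mul]
  ring

end Cross

/-! ### Functions on a manifold read in overlapping charts -/

section InChart

variable {n : ℕ} {S : Type*} [TopologicalSpace S] [ChartedSpace (Eu n) S] [IsManifold (𝓡 n) ∞ S]
  {F : Type*} [NormedAddCommGroup F] [NormedSpace ℝ F] {φ : S → F} {p q : S} {u : Eu n}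

theorem contDiffAt_comp_symm (hφ : ContMDiff (𝓡 n) 𝓘(ℝ, F) ∞ φ)
    (hu : u ∈ (extChartAt (𝓡 n) p).target) :
    ContDiffAt ℝ ∞ (φ ∘ (extChartAt (𝓡 n) p).symm) u :=
  ((hφ _).comp u (contMDiffAt_extChartAt_symm p hu)).contDiffAt

theorem fderiv_comp_symm (hφ : ContMDiff (𝓡 n) 𝓘(ℝ, F) ∞ φ)
    (hu : u ∈ (extChartAt (𝓡 n) p).target) (v : Eu n) :
    fderiv ℝ (φ ∘ (extChartAt (𝓡 n) p).symm) u v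
      = mfderiv (𝓡 n) 𝓘(ℝ, F) φ ((extChartAt (𝓡 n) p).symm u) (chartSymmDeriv p u v) := by
  have h := mfderiv_comp u ((hφ.mdifferentiable (by norm_num)) _)
    ((contMDiffAt_extChartAt_symm p hu).mdifferentiableAt (by norm_num))
  rw [← mfderiv_eq_fderiv]
  exact congrArg (fun L => L v) h

variable (p q) in
/-- The part of the chart domain around `q` on which the chart around `p` is defined, in
coordinates. -/
def overlap : Set (Eu n) :=
  (extChartAt (𝓡 n) q).target ∩ (extChartAt (𝓡 n) q).symm ⁻¹' (chartAt (Eu n) p).source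

omit [IsManifold (𝓡 n) ∞ S] in
theorem isOpen_overlap : IsOpen (overlap (n := n) p q) :=
  (continuousOn_extChartAt_symm q).isOpen_inter_preimage (isOpen_extChartAt_target q)
    (chartAt (Eu n) p).open_source

omit [IsManifold (𝓡 n) ∞ S] in
theorem symm_transition (hu : u ∈ overlap p q) :
    (extChartAt (𝓡 n) p).symm (transition p q u) = (extChartAt (𝓡 n) q).symm u :=
  (extChartAt (𝓡 n) p).left_inv (by rw [extChartAt_source]; exact hu.2)

omit [IsManifold (𝓡 n) ∞ S] in
theorem transition_mem (hu : u ∈ overlap p q) : transition p q u ∈ overlap q p := by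
  refine ⟨(extChartAt (𝓡 n) p).map_source (by rw [extChartAt_source]; exact hu.2), ?_⟩
  rw [Set.mem_preimage, symm_transition hu, ← extChartAt_source (𝓡 n)]
  exact (extChartAt (𝓡 n) q).map_target hu.1

omit [IsManifold (𝓡 n) ∞ S] in
theorem transition_transition (hu : u ∈ overlap p q) : transition q p (transition p q u) = u := by
  rw [transition, symm_transition hu, (extChartAt (𝓡 n) q).right_inv hu.1]

theorem hasFDerivAt_transition (hu : u ∈ overlap p q) :
    HasFDerivAt (transition p q) (fderiv ℝ (transition p q) u) u :=
  ((contDiffAt_transition hu.1 hu.2).differentiableAt (by norm_num)).hasFDerivAt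

theorem fderiv_comp_symm_transition (hφ : ContMDiff (𝓡 n) 𝓘(ℝ, F) ∞ φ) (hu : u ∈ overlap p q)
    (v : Eu n) :
    fderiv ℝ (φ ∘ (extChartAt (𝓡 n) q).symm) u v
      = fderiv ℝ (φ ∘ (extChartAt (𝓡 n) p).symm) (transition p q u)
        (fderiv ℝ (transition p q) u v) := by
  have h1 := ((contDiffAt_comp_symm hφ (transition_mem hu).1).differentiableAt
    (by norm_num)).hasFDerivAt.comp u (hasFDerivAt_transition hu)
  have h2 : φ ∘ (extChartAt (𝓡 n) q).symm
      =ᶠ[nhds u] (φ ∘ (extChartAt (𝓡 n) p).symm) ∘ transition p q := by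
    filter_upwards [(isOpen_overlap (p := p) (q := q)).mem_nhds hu] with z hz
    exact congrArg φ (symm_transition hz).symm
  rw [h2.fderiv_eq, h1.fderiv]
  rfl

end InChart

/-! ### Area form, brackets and integrals over chart domains of an immersed surface -/

section Surface

variable {S : Type*} [TopologicalSpace S] [ChartedSpace (Eu 2) S] [IsManifold (𝓡 2) ∞ S]
  {U : Set (Eu 3)}

namespace ImmersedSurface

variable (A : ImmersedSurface S U) {p q : S} {u : Eu 2} {a b : S → ℝ}

theorem inner_normal_fderiv (hu : u ∈ (extChartAt (𝓡 2) p).target) (v : Eu 2) :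
    inner ℝ (A.ν ((extChartAt (𝓡 2) p).symm u))
      (fderiv ℝ (A.f ∘ (extChartAt (𝓡 2) p).symm) u v) = 0 := by
  rw [fderiv_comp_symm A.smooth hu]
  exact A.ν_orthogonal _ _

theorem injective_fderiv (hu : u ∈ (extChartAt (𝓡 2) p).target) :
    Function.Injective (fderiv ℝ (A.f ∘ (extChartAt (𝓡 2) p).symm) u) := by
  intro v w h
  rw [fderiv_comp_symm A.smooth hu, fderiv_comp_symm A.smooth hu] at h
  have h1 := congrArg (chartDeriv p ((extChartAt (𝓡 2) p).symm u)) (A.immersion _ h)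
  rwa [chartDeriv_chartSymmDeriv p hu, chartDeriv_chartSymmDeriv p hu] at h1

/-- The component of the area form of the surface in the chart around `p`, for the orientation
given by the normal. -/
def areaForm (p : S) (u : Eu 2) : ℝ :=
  ∑ i, A.ν ((extChartAt (𝓡 2) p).symm u) i *
    cross (fderiv ℝ (A.f ∘ (extChartAt (𝓡 2) p).symm) u (e 0))
      (fderiv ℝ (A.f ∘ (extChartAt (𝓡 2) p).symm) u (e 1)) i

theorem areaForm_ne_zero (hu : u ∈ (extChartAt (𝓡 2) p).target) : A.areaForm p u ≠ 0 :=
  sum_mul_cross_ne_zero (A.ν_unit _) (A.inner_normal_fderiv hu) (A.injective_fderiv hu)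

theorem areaForm_transition (hu : u ∈ overlap p q) :
    A.areaForm q u = (fderiv ℝ (transition p q) u).det * A.areaForm p (transition p q u) := by
  rw [areaForm, areaForm, symm_transition hu, Finset.mul_sum]
  simp only [fderiv_comp_symm_transition A.smooth hu, cross_comp]
  exact Finset.sum_congr rfl fun i _ => by ring

theorem continuousOn_areaForm : ContinuousOn (A.areaForm p) (extChartAt (𝓡 2) p).target := by
  have hF (i : Fin 3) (v : Eu 2) : ContinuousOn
      (fun u => fderiv ℝ (A.f ∘ (extChartAt (𝓡 2) p).symm) u v i) (extChartAt (𝓡 2) p).target := by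
    intro u hu
    have h := (((contDiffAt_comp_symm A.smooth hu).fderiv_right (m := 0)
      (by norm_num)).clm_apply (contDiffAt_const (c := v))).continuousAt
    exact ((EuclideanSpace.proj i : Eu 3 →L[ℝ] ℝ).continuous.continuousAt.comp
      h).continuousWithinAt
  have hν (i : Fin 3) : ContinuousOn (fun u => A.ν ((extChartAt (𝓡 2) p).symm u) i)
      (extChartAt (𝓡 2) p).target :=
    ((EuclideanSpace.proj i : Eu 3 →L[ℝ] ℝ).continuous.comp A.ν_continuous).comp_continuousOn
      (continuousOn_extChartAt_symm p)
  unfold areaForm cross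
  exact continuousOn_finsetSum _ fun i _ => (hν i).mul
    (continuousOn_finsetSum _ fun m _ => continuousOn_finsetSum _ fun l _ =>
      continuousOn_const.mul ((hF m _).mul (hF l _)))

variable (a b) in
/-- The ratio of `da ∧ db` and the area form. -/
def bracket (q : S) : ℝ :=
  wedge (a ∘ (extChartAt (𝓡 2) q).symm) (b ∘ (extChartAt (𝓡 2) q).symm)
    (extChartAt (𝓡 2) q q) (e 0) (e 1) / A.areaForm q (extChartAt (𝓡 2) q q)

/-- The bracket at each point is defined in that point's own chart; here it is identified in one
fixed chart, as numerator and denominator pick up the same determinant. -/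
theorem bracket_mul_areaForm (ha : ContMDiff (𝓡 2) 𝓘(ℝ, ℝ) ∞ a)
    (hb : ContMDiff (𝓡 2) 𝓘(ℝ, ℝ) ∞ b) (hu : u ∈ (extChartAt (𝓡 2) p).target) :
    A.bracket a b ((extChartAt (𝓡 2) p).symm u) * A.areaForm p u
      = wedge (a ∘ (extChartAt (𝓡 2) p).symm) (b ∘ (extChartAt (𝓡 2) p).symm) u (e 0) (e 1) := by
  set q := (extChartAt (𝓡 2) p).symm u with hq
  have ho : u ∈ overlap q p := ⟨hu, mem_chart_source _ _⟩
  have ht : transition q p u = extChartAt (𝓡 2) q q := rfl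
  have hw : wedge (a ∘ (extChartAt (𝓡 2) p).symm) (b ∘ (extChartAt (𝓡 2) p).symm) u (e 0) (e 1)
      = (fderiv ℝ (transition q p) u).det * wedge (a ∘ (extChartAt (𝓡 2) q).symm)
        (b ∘ (extChartAt (𝓡 2) q).symm) (transition q p u) (e 0) (e 1) := by
    rw [wedge, wedge]
    simp only [fderiv_comp_symm_transition ha ho, fderiv_comp_symm_transition hb ho]
    exact wedge_comp _ _ _
  rw [hw, A.areaForm_transition ho, bracket, ← ht]
  have := A.areaForm_ne_zero (transition_mem ho).1
  field_simp

theorem continuous_of_mul_areaForm {k : S → ℝ} (h : ∀ p, ContinuousOn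
    (fun u => k ((extChartAt (𝓡 2) p).symm u) * A.areaForm p u) (extChartAt (𝓡 2) p).target) :
    Continuous k := by
  refine continuous_iff_continuousAt.2 fun q => ?_
  have hu := mem_extChartAt_target (I := 𝓡 2) q
  have hn := (isOpen_extChartAt_target (I := 𝓡 2) q).mem_nhds hu
  have h1 := ((h q).continuousAt hn).div (A.continuousOn_areaForm.continuousAt hn)
    (A.areaForm_ne_zero hu)
  refine (h1.comp (continuousAt_extChartAt (I := 𝓡 2) q)).congr ?_
  filter_upwards [extChartAt_source_mem_nhds (I := 𝓡 2) q] with x hx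
  rw [Function.comp_apply, Pi.div_apply, mul_div_cancel_right₀ _
    (A.areaForm_ne_zero ((extChartAt (𝓡 2) q).map_source hx)), (extChartAt (𝓡 2) q).left_inv hx]

theorem continuous_bracket (ha : ContMDiff (𝓡 2) 𝓘(ℝ, ℝ) ∞ a)
    (hb : ContMDiff (𝓡 2) 𝓘(ℝ, ℝ) ∞ b) : Continuous (A.bracket a b) := by
  refine A.continuous_of_mul_areaForm fun p => ContinuousOn.congr ?_ fun u hu =>
    A.bracket_mul_areaForm ha hb hu
  intro u hu
  have h {c : S → ℝ} (hc : ContMDiff (𝓡 2) 𝓘(ℝ, ℝ) ∞ c) (v : Eu 2) :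
      ContinuousAt (fun u => fderiv ℝ (c ∘ (extChartAt (𝓡 2) p).symm) u v) u :=
    (((contDiffAt_comp_symm hc hu).fderiv_right (m := 0) (by norm_num)).clm_apply
      (contDiffAt_const (c := v))).continuousAt
  exact (((h ha _).mul (h hb _)).sub ((h ha _).mul (h hb _))).continuousWithinAt

theorem sum_bracket {ι : Type*} {s : Finset ι} {a : ι → S → ℝ}
    (ha : ∀ i, ContMDiff (𝓡 2) 𝓘(ℝ, ℝ) ∞ (a i)) (q : S) :
    ∑ i ∈ s, A.bracket (a i) b q = A.bracket (fun x => ∑ i ∈ s, a i x) b q := by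
  have h : fderiv ℝ ((fun x => ∑ i ∈ s, a i x) ∘ (extChartAt (𝓡 2) q).symm) (extChartAt (𝓡 2) q q)
      = ∑ i ∈ s, fderiv ℝ (a i ∘ (extChartAt (𝓡 2) q).symm) (extChartAt (𝓡 2) q q) :=
    (HasFDerivAt.fun_sum fun i _ => ((contDiffAt_comp_symm (ha i)
      (mem_extChartAt_target q)).differentiableAt (by norm_num)).hasFDerivAt).fderiv
  simp only [bracket, wedge, h, sum_apply, ← Finset.sum_div, Finset.sum_sub_distrib,
    Finset.sum_mul]

/-- Lagrange's identity. The absolute value is needed because a chart need not respect the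
orientation given by `ν`. -/
theorem areaDensity_eq_abs (hu : u ∈ (extChartAt (𝓡 2) p).target) :
    A.areaDensity p u = |A.areaForm p u| := by
  rw [← Real.sqrt_sq_eq_abs, areaForm, sq_sum_mul_cross (A.ν_unit _)
    (A.inner_normal_fderiv hu _) (A.inner_normal_fderiv hu _), areaDensity, Matrix.det_fin_two]
  rfl

/-- Integral of a function over the domain of the chart around `p`. -/
def chartIntegral (p : S) (k : S → ℝ) : ℝ :=
  ∫ u in (extChartAt (𝓡 2) p).target, k ((extChartAt (𝓡 2) p).symm u) * A.areaDensity p u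

open MeasureTheory

omit [IsManifold (𝓡 2) ∞ S] in
theorem chartIntegral_eq_overlap {k : S → ℝ}
    (hk : ∀ x, x ∉ (chartAt (Eu 2) q).source → k x = 0) : A.chartIntegral p k
      = ∫ u in overlap q p, k ((extChartAt (𝓡 2) p).symm u) * A.areaDensity p u := by
  refine setIntegral_eq_of_subset_of_forall_sdiff_eq_zero
    (isOpen_extChartAt_target p).measurableSet Set.inter_subset_left fun u hu => ?_
  rw [hk _ fun h => hu.2 ⟨hu.1, h⟩, zero_mul]

/-- The integral of a function supported in the domains of two charts. -/
theorem chartIntegral_eq_chartIntegral {k : S → ℝ}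
    (hp : ∀ x, x ∉ (chartAt (Eu 2) p).source → k x = 0)
    (hq : ∀ x, x ∉ (chartAt (Eu 2) q).source → k x = 0) :
    A.chartIntegral p k = A.chartIntegral q k := by
  rw [A.chartIntegral_eq_overlap hq, A.chartIntegral_eq_overlap hp]
  have himg : transition p q '' (overlap p q : Set (Eu 2)) = overlap q p := by
    ext u
    refine ⟨?_, fun hu => ⟨_, transition_mem hu, transition_transition hu⟩⟩
    rintro ⟨z, hz, rfl⟩
    exact transition_mem hz
  have hinj : Set.InjOn (transition p q) (overlap p q : Set (Eu 2)) := fun z hz z' hz' h => by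
    rw [← transition_transition hz, h, transition_transition hz']
  rw [← himg, integral_image_eq_integral_abs_det_fderiv_smul volume
    (isOpen_overlap (p := p) (q := q)).measurableSet
    (fun u hu => (hasFDerivAt_transition hu).hasFDerivWithinAt) hinj]
  refine setIntegral_congr_fun (isOpen_overlap (p := p) (q := q)).measurableSet fun u hu => ?_
  rw [symm_transition hu, A.areaDensity_eq_abs (transition_mem hu).1, A.areaDensity_eq_abs hu.1,
    A.areaForm_transition hu, abs_mul, smul_eq_mul]
  ring

variable [CompactSpace S]

omit [IsManifold (𝓡 2) ∞ S] in
theorem isCompact_image_tsupport {k : S → ℝ} (hk : tsupport k ⊆ (chartAt (Eu 2) p).source) :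
    IsCompact (extChartAt (𝓡 2) p '' tsupport k)
      ∧ extChartAt (𝓡 2) p '' tsupport k ⊆ (extChartAt (𝓡 2) p).target
      ∧ ∀ u ∈ (extChartAt (𝓡 2) p).target \ extChartAt (𝓡 2) p '' tsupport k,
        k ((extChartAt (𝓡 2) p).symm u) = 0 := by
  have hk' : tsupport k ⊆ (extChartAt (𝓡 2) p).source := by rwa [extChartAt_source]
  refine ⟨(isClosed_tsupport k).isCompact.image_of_continuousOn
    ((continuousOn_extChartAt p).mono hk'), ?_, fun u hu => ?_⟩
  · rintro _ ⟨x, hx, rfl⟩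
    exact (extChartAt (𝓡 2) p).map_source (hk' hx)
  · by_contra h
    exact hu.2 ⟨_, subset_tsupport _ h, (extChartAt (𝓡 2) p).right_inv hu.1⟩

theorem integrableOn_chart {k : S → ℝ} (hc : Continuous k)
    (hk : tsupport k ⊆ (chartAt (Eu 2) p).source) :
    IntegrableOn (fun u => k ((extChartAt (𝓡 2) p).symm u) * A.areaDensity p u)
      (extChartAt (𝓡 2) p).target := by
  obtain ⟨h1, h2, h3⟩ := isCompact_image_tsupport hk
  refine integrableOn_of_continuousOn (isOpen_extChartAt_target p) h1 h2 ?_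
    fun u hu => by rw [h3 u hu, zero_mul]
  exact (hc.comp_continuousOn (continuousOn_extChartAt_symm p)).mul
    (A.continuousOn_areaForm.abs.congr fun u hu => A.areaDensity_eq_abs hu)

/-- Bracket times area density is `± da ∧ db`, with the sign of the area form, so the planar Stokes
theorem applies. -/
theorem chartIntegral_bracket (ha : ContMDiff (𝓡 2) 𝓘(ℝ, ℝ) ∞ a)
    (hb : ContMDiff (𝓡 2) 𝓘(ℝ, ℝ) ∞ b) (hs : tsupport a ⊆ (chartAt (Eu 2) p).source) :
    A.chartIntegral p (A.bracket a b) = 0 := by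
  obtain ⟨h1, h2, h3⟩ := isCompact_image_tsupport hs
  have h := setIntegral_sign_mul_wedge (μ := volume) (isOpen_extChartAt_target p) h1 h2
    (fun u hu => (contDiffAt_comp_symm ha hu).of_le (by norm_cast))
    (fun u hu => (contDiffAt_comp_symm hb hu).of_le (by norm_cast))
    A.continuousOn_areaForm (fun u hu => A.areaForm_ne_zero hu) h3 (e 0) (e 1)
  rw [← h]
  refine setIntegral_congr_fun (isOpen_extChartAt_target p).measurableSet fun u hu => ?_
  rw [← A.bracket_mul_areaForm ha hb hu, A.areaDensity_eq_abs hu, mul_left_comm,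
    sign_mul_self_eq_abs]

theorem chartIntegral_sub {k k' : S → ℝ} (hc : Continuous k) (hc' : Continuous k')
    (hk : tsupport k ⊆ (chartAt (Eu 2) p).source) (hk' : tsupport k' ⊆ (chartAt (Eu 2) p).source) :
    A.chartIntegral p (fun x => k x - k' x) = A.chartIntegral p k - A.chartIntegral p k' := by
  simp only [chartIntegral, sub_mul]
  exact integral_sub (A.integrableOn_chart hc hk) (A.integrableOn_chart hc' hk')

theorem chartIntegral_sum {ι : Type*} {t : Finset ι} {k : ι → S → ℝ} (hc : ∀ i, Continuous (k i))
    (hk : ∀ i, tsupport (k i) ⊆ (chartAt (Eu 2) p).source) :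
    A.chartIntegral p (fun x => ∑ i ∈ t, k i x) = ∑ i ∈ t, A.chartIntegral p (k i) := by
  simp only [chartIntegral, Finset.sum_mul]
  exact integral_finsetSum t fun i _ => A.integrableOn_chart (hc i) (hk i)

omit [CompactSpace S] in
theorem tsupport_bracket_subset : tsupport (A.bracket a b) ⊆ tsupport a := by
  refine closure_minimal (fun q hq => ?_) (isClosed_tsupport a)
  by_contra h
  have hu := mem_extChartAt_target (I := 𝓡 2) q
  have h1 : Filter.Tendsto (extChartAt (𝓡 2) q).symm (nhds (extChartAt (𝓡 2) q q)) (nhds q) := by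
    have h2 := (contMDiffAt_extChartAt_symm q hu).continuousAt
    rwa [ContinuousAt, (extChartAt (𝓡 2) q).left_inv (mem_extChartAt_source q)] at h2
  have h3 : a ∘ (extChartAt (𝓡 2) q).symm =ᶠ[nhds (extChartAt (𝓡 2) q q)] fun _ => 0 :=
    h1.eventually (notMem_tsupport_iff_eventuallyEq.1 h)
  exact hq (by rw [bracket, wedge, h3.fderiv_eq]; simp)

end ImmersedSurface

end Surface

/-! ### Stokes' theorem on a closed surface -/

section ClosedSurface

variable {S : Type*} [TopologicalSpace S] [ChartedSpace (Eu 2) S] [IsManifold (𝓡 2) ∞ S]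
  [CompactSpace S] [T2Space S] {U : Set (Eu 3)}

open MeasureTheory

variable (S) in
-- Compactness makes the locally finite partition finite, which replaces the `finsum` in the area
-- integral by a finite sum.
theorem exists_finset_chartPartition : ∃ s : Finset S,
    (∀ p ∉ s, ∀ x, chartPartition S p x = 0) ∧ ∀ x, ∑ p ∈ s, chartPartition S p x = 1 := by
  have hf := (chartPartition S).locallyFinite.finite_nonempty_of_compact
  have h0 : ∀ p ∉ hf.toFinset, ∀ x, chartPartition S p x = 0 := fun p hp x => by
    by_contra h
    exact hp (hf.mem_toFinset.2 ⟨x, h⟩)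
  refine ⟨hf.toFinset, h0, fun x => (chartPartition S).sum_finsupport' x (Set.mem_univ x) ?_⟩
  intro p hp
  rw [SmoothPartitionOfUnity.mem_finsupport] at hp
  exact not_imp_comm.1 (h0 p) fun h => hp (h x)

theorem tsupport_chartPartition_mul (h : S → ℝ) (p : S) :
    tsupport (fun x => chartPartition S p x * h x) ⊆ (chartAt (Eu 2) p).source :=
  (tsupport_mul_subset_left (f := chartPartition S p) (g := h)).trans
    (chartPartition_isSubordinate S p)

theorem chartPartition_eq_zero {p x : S} (hx : x ∉ (chartAt (Eu 2) p).source) :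
    chartPartition S p x = 0 :=
  image_eq_zero_of_notMem_tsupport fun h => hx (chartPartition_isSubordinate S p h)

theorem continuous_chartPartition (p : S) : Continuous (chartPartition S p) :=
  (chartPartition S p).contMDiff.continuous

namespace ImmersedSurface

variable (A : ImmersedSurface S U) {a b h h' k : S → ℝ} {p : S}

theorem areaIntegral_eq_sum {s : Finset S} (hs : ∀ p ∉ s, ∀ x, chartPartition S p x = 0)
    (h : S → ℝ) :
    A.areaIntegral h = ∑ p ∈ s, A.chartIntegral p (fun x => chartPartition S p x * h x) := by
  refine finsum_eq_sum_of_support_subset _ fun p hp => ?_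
  by_contra h
  exact hp (by simp [hs p h])

theorem areaIntegral_sub (hh : Continuous h) (hh' : Continuous h') :
    A.areaIntegral (fun x => h x - h' x) = A.areaIntegral h - A.areaIntegral h' := by
  obtain ⟨s, hs, -⟩ := exists_finset_chartPartition S
  simp only [A.areaIntegral_eq_sum hs, ← Finset.sum_sub_distrib, mul_sub]
  exact Finset.sum_congr rfl fun p _ => A.chartIntegral_sub
    ((continuous_chartPartition p).mul hh) ((continuous_chartPartition p).mul hh')
    (tsupport_chartPartition_mul h p) (tsupport_chartPartition_mul h' p)

theorem areaIntegral_sum {ι : Type*} {t : Finset ι} {h : ι → S → ℝ} (hh : ∀ i, Continuous (h i)) :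
    A.areaIntegral (fun x => ∑ i ∈ t, h i x) = ∑ i ∈ t, A.areaIntegral (h i) := by
  obtain ⟨s, hs, -⟩ := exists_finset_chartPartition S
  simp only [A.areaIntegral_eq_sum hs, Finset.mul_sum]
  rw [Finset.sum_comm]
  exact Finset.sum_congr rfl fun p _ => A.chartIntegral_sum
    (fun i => (continuous_chartPartition p).mul (hh i)) fun i => tsupport_chartPartition_mul (h i) p

/-- The integral of a function supported in the domain of a chart. -/
theorem areaIntegral_eq_chartIntegral (hk : Continuous k)
    (hkp : tsupport k ⊆ (chartAt (Eu 2) p).source) : A.areaIntegral k = A.chartIntegral p k := by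
  obtain ⟨s, hs, hs1⟩ := exists_finset_chartPartition S
  have hk0 : ∀ x ∉ (chartAt (Eu 2) p).source, k x = 0 := fun x hx =>
    image_eq_zero_of_notMem_tsupport fun h => hx (hkp h)
  have h1 (q : S) : A.chartIntegral q (fun x => chartPartition S q x * k x)
      = A.chartIntegral p (fun x => chartPartition S q x * k x) :=
    A.chartIntegral_eq_chartIntegral (fun x hx => by rw [chartPartition_eq_zero hx, zero_mul])
      fun x hx => by rw [hk0 x hx, mul_zero]
  simp only [A.areaIntegral_eq_sum hs, h1]
  rw [← A.chartIntegral_sum (k := fun q x => chartPartition S q x * k x)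
    (fun q => (continuous_chartPartition q).mul hk)
    fun q => (tsupport_mul_subset_right (f := chartPartition S q) (g := k)).trans hkp]
  simp only [← Finset.sum_mul, hs1, one_mul]

/-- Stokes' theorem: the integral of `da ∧ db` over a closed surface vanishes. -/
theorem areaIntegral_bracket (ha : ContMDiff (𝓡 2) 𝓘(ℝ, ℝ) ∞ a)
    (hb : ContMDiff (𝓡 2) 𝓘(ℝ, ℝ) ∞ b) : A.areaIntegral (A.bracket a b) = 0 := by
  obtain ⟨s, -, hs1⟩ := exists_finset_chartPartition S
  have hρ (p : S) : ContMDiff (𝓡 2) 𝓘(ℝ, ℝ) ∞ (fun x => chartPartition S p x * a x) :=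
    (chartPartition S p).contMDiff.mul ha
  -- The bracket is additive in its first argument, so only `a` has to be localised by the partition
  -- of unity; `b` stays global.
  have h1 : A.bracket a b
      = fun q => ∑ p ∈ s, A.bracket (fun x => chartPartition S p x * a x) b q := by
    funext q
    rw [A.sum_bracket hρ]
    simp only [← Finset.sum_mul, hs1, one_mul]
  rw [h1, A.areaIntegral_sum fun p => A.continuous_bracket (hρ p) hb]
  refine Finset.sum_eq_zero fun p _ => ?_
  have ht := tsupport_chartPartition_mul a p
  rw [A.areaIntegral_eq_chartIntegral (A.continuous_bracket (hρ p) hb)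
    (A.tsupport_bracket_subset.trans ht), A.chartIntegral_bracket (hρ p) hb ht]

omit [IsManifold (𝓡 2) ∞ S] [CompactSpace S] [T2Space S] in
theorem contMDiff_comp {F : Eu 3 → ℝ} (hF : ∀ x ∈ U, ContDiffAt ℝ ∞ F x) :
    ContMDiff (𝓡 2) 𝓘(ℝ, ℝ) ∞ fun x => F (A.f x) :=
  fun x => (hF _ (A.mem x)).contMDiffAt.comp x (A.smooth x)

omit [CompactSpace S] [T2Space S] in
theorem fderiv_comp_param {F : Eu 3 → ℝ} (hF : ∀ x ∈ U, ContDiffAt ℝ ∞ F x) (q : S) (v : Eu 2) :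
    fderiv ℝ ((fun x => F (A.f x)) ∘ (extChartAt (𝓡 2) q).symm) (extChartAt (𝓡 2) q q) v
      = ∑ m, fderiv ℝ (A.f ∘ (extChartAt (𝓡 2) q).symm) (extChartAt (𝓡 2) q q) v m
        * pd m F (A.f q) := by
  have hq : (A.f ∘ (extChartAt (𝓡 2) q).symm) (extChartAt (𝓡 2) q q) = A.f q :=
    congrArg A.f ((extChartAt (𝓡 2) q).left_inv (mem_extChartAt_source q))
  have h1 := ((hF _ (A.mem q)).differentiableAt (by norm_num)).hasFDerivAt
  rw [← hq] at h1
  have h2 := ((contDiffAt_comp_symm A.smooth (mem_extChartAt_target q)).differentiableAt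
    (by norm_num)).hasFDerivAt
  have h3 := (h1.comp _ h2).fderiv
  rw [hq] at h3
  exact (congrArg (fun L => L v) h3).trans (sum_apply_e (fderiv ℝ F (A.f q)) _)

omit [CompactSpace S] [T2Space S] in
/-- The normal component of a curl, in terms of brackets of functions on the surface. -/
theorem sum_curl_mul_normal {V : Eu 3 → Fin 3 → ℝ}
    (hV : ∀ x ∈ U, ∀ l, ContDiffAt ℝ ∞ (fun y => V y l) x) (q : S) :
    ∑ i, curl V (A.f q) i * A.ν q i
      = ∑ l, A.bracket (fun x => V (A.f x) l) (fun x => A.f x l) q := by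
  have hu := mem_extChartAt_target (I := 𝓡 2) q
  have hq : (extChartAt (𝓡 2) q).symm (extChartAt (𝓡 2) q q) = q :=
    (extChartAt (𝓡 2) q).left_inv (mem_extChartAt_source q)
  have hx (l : Fin 3) (v : Eu 2) : fderiv ℝ ((fun x => A.f x l) ∘ (extChartAt (𝓡 2) q).symm)
      (extChartAt (𝓡 2) q q) v
      = fderiv ℝ (A.f ∘ (extChartAt (𝓡 2) q).symm) (extChartAt (𝓡 2) q q) v l := by
    have h := (EuclideanSpace.proj l : Eu 3 →L[ℝ] ℝ).hasFDerivAt.comp _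
      ((contDiffAt_comp_symm A.smooth hu).differentiableAt (by norm_num)).hasFDerivAt
    exact congrArg (fun L => L v) h.fderiv
  have hn := fun v => A.inner_normal_fderiv hu v
  rw [hq] at hn
  have hc := cross_mul_sum (A.ν_unit q) (hn (e 0)) (hn (e 1))
  have hD : A.areaForm q (extChartAt (𝓡 2) q q) = ∑ i, A.ν q i *
      cross (fderiv ℝ (A.f ∘ (extChartAt (𝓡 2) q).symm) (extChartAt (𝓡 2) q q) (e 0))
      (fderiv ℝ (A.f ∘ (extChartAt (𝓡 2) q).symm) (extChartAt (𝓡 2) q q) (e 1)) i := by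
    rw [areaForm, hq]
  simp only [bracket]
  rw [← Finset.sum_div, eq_div_iff (A.areaForm_ne_zero hu), hD, Finset.sum_mul]
  -- Area form times `ν_i` is the cross product of the coordinate tangent vectors; the rest is `∑
  -- dV_l ∧ dx_l = curl V · (∂_0 f × ∂_1 f)`.
  simp only [mul_assoc, mul_comm (A.ν q _) (∑ j, _), hc]
  simp only [wedge, hx, fun l => A.fderiv_comp_param (fun x hx => hV x hx l) q]
  simp only [curl, cross_eq_sub, Fin.sum_univ_three, symb_three]
  simp
  ring

/-- The flux of a curl through a closed surface vanishes. -/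
theorem areaIntegral_curl {V : Eu 3 → Fin 3 → ℝ}
    (hV : ∀ x ∈ U, ∀ l, ContDiffAt ℝ ∞ (fun y => V y l) x) :
    Continuous (fun q => ∑ i, curl V (A.f q) i * A.ν q i)
      ∧ A.areaIntegral (fun q => ∑ i, curl V (A.f q) i * A.ν q i) = 0 := by
  have h1 (l : Fin 3) := A.contMDiff_comp (fun x hx => hV x hx l)
  have h2 (l : Fin 3) : ContMDiff (𝓡 2) 𝓘(ℝ, ℝ) ∞ fun x => A.f x l :=
    A.contMDiff_comp fun x _ => (EuclideanSpace.proj l : Eu 3 →L[ℝ] ℝ).contDiff.contDiffAt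
  have h3 : (fun q => ∑ i, curl V (A.f q) i * A.ν q i)
      = fun q => ∑ l, A.bracket (fun x => V (A.f x) l) (fun x => A.f x l) q :=
    funext (A.sum_curl_mul_normal hV)
  have h4 (l : Fin 3) := A.continuous_bracket (h1 l) (h2 l)
  rw [h3, A.areaIntegral_sum h4]
  exact ⟨continuous_finsetSum _ fun l _ => h4 l,
    Finset.sum_eq_zero fun l _ => A.areaIntegral_bracket (h1 l) (h2 l)⟩

end ImmersedSurface

end ClosedSurface

/-! ### Equality of the fluxes -/

section Flux

variable {M : Type*} [TopologicalSpace M] [ChartedSpace (Eu 4) M] [IsManifold (𝓡 4) ∞ M]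
  {g : LorentzianMetric M} {Sg : FlatHypersurface g}
  {S : Type*} [TopologicalSpace S] [ChartedSpace (Eu 2) S] [IsManifold (𝓡 2) ∞ S]
  (A : ImmersedSurface S Sg.U)

namespace ImmersedSurface

omit [IsManifold (𝓡 2) ∞ S] in
theorem continuous_admMomentum_rotation (k : Fin 3) : Continuous fun p =>
    ∑ i, ∑ j, Sg.admMomentum (A.f p) i j * rotation k (A.f p) j * A.ν p i := by
  have hf (j : Fin 3) : Continuous fun p => A.f p j :=
    (EuclideanSpace.proj j : Eu 3 →L[ℝ] ℝ).continuous.comp A.smooth.continuous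
  have hν (j : Fin 3) : Continuous fun p => A.ν p j :=
    (EuclideanSpace.proj j : Eu 3 →L[ℝ] ℝ).continuous.comp A.ν_continuous
  have hK (i j : Fin 3) : Continuous fun p => Sg.extrinsic (A.f p) i j :=
    (A.contMDiff_comp (F := fun x => Sg.extrinsic x i j)
      fun x hx => FlatHypersurface.contDiffAt_extrinsic hx i j).continuous
  have hP (i j : Fin 3) : Continuous fun p => Sg.admMomentum (A.f p) i j :=
    (hK i j).neg.add ((continuous_finsetSum _ fun l _ => hK l l).mul continuous_const)
  have hR (j : Fin 3) : Continuous fun p => rotation k (A.f p) j :=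
    continuous_finsetSum _ fun i _ => continuous_const.mul (hf i)
  exact continuous_finsetSum _ fun i _ => continuous_finsetSum _ fun j _ =>
    ((hP i j).mul (hR j)).mul (hν i)

/-- The flux of the magnetic part along a proper conformal Killing field is the flux of the
momentum along the corresponding rotation. -/
theorem flux_magnetic_properConformal [CompactSpace S] [T2Space S] (hvac : g.IsVacuum)
    (k : Fin 3) :
    A.flux Sg.magnetic (properConformal k) = A.flux Sg.admMomentum (rotation k) := by
  have hV : ∀ x ∈ Sg.U, ∀ l, ContDiffAt ℝ ∞
      (fun y => ∑ j, Sg.extrinsic y l j * properConformal k y j) x := fun x hx l =>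
    ContDiffAt.sum fun j _ => (FlatHypersurface.contDiffAt_extrinsic hx l j).mul
      (contDiff_properConformal k j).contDiffAt
  obtain ⟨hc, h0⟩ := A.areaIntegral_curl hV
  -- The subtracted zero is rewritten as the flux of the curl of `K_{lj} X^j`, so that the two
  -- integrands agree pointwise.
  rw [flux, flux, ← sub_zero (A.areaIntegral fun p => ∑ i, ∑ j,
    Sg.admMomentum (A.f p) i j * rotation k (A.f p) j * A.ν p i), ← h0,
    ← A.areaIntegral_sub (A.continuous_admMomentum_rotation k) hc]
  congr 1
  funext p
  simp only [← Finset.sum_mul, ← Finset.sum_sub_distrib, ← sub_mul,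
    FlatHypersurface.sum_magnetic_mul_properConformal hvac (A.mem p)]

end ImmersedSurface

end Flux

end FlatSlice

end

theorem mainTheorem5
    {M : Type*} [TopologicalSpace M] [ChartedSpace (FlatSlice.Eu 4) M] [IsManifold (𝓡 4) ∞ M]
    (g : FlatSlice.LorentzianMetric M) (hvac : g.IsVacuum)
    (Sg : FlatSlice.FlatHypersurface g)
    (hdiv : ∀ x ∈ Sg.U, ∀ j : Fin 3,
      ∑ i, FlatSlice.pd i (fun y => Sg.magnetic y i j) x = 0)
    {S : Type*} [TopologicalSpace S] [ChartedSpace (FlatSlice.Eu 2) S] [IsManifold (𝓡 2) ∞ S]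
    [CompactSpace S] [T2Space S]
    (A : FlatSlice.ImmersedSurface S Sg.U)
    (hQ : ∀ k : Fin 3, A.flux Sg.magnetic (FlatSlice.translation k) = 0)
    (k : Fin 3) :
    A.flux Sg.magnetic (FlatSlice.properConformal k)
      = A.flux Sg.admMomentum (FlatSlice.rotation k) :=
  A.flux_magnetic_properConformal hvac k
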